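/- Let $C$ be a projective curve over a field $k$, that is, an integral $k$-scheme of dimension one which is isomorphic over $k$ to a closed subscheme of some projective space $\mathbb P^n_k$. Let $\eta$ be its generic point, $P \in C$ a closed point at which $C$ is smooth over $k$, and $\mathcal F$ a coherent torsion-free sheaf on $C$. For a closed point $x$ let $\hat{\mathcal O}_x$ and $\hat{\mathcal F}_x$ be the $\mathfrak m_x$-adic completions of the stalks $\mathcal O_x$ and $\mathcal F_x$, and let $K_x$ be the total ring of fractions of $\hat{\mathcal O}_x$. Let $\prod'_{x}(\hat{\mathcal F}_x\otimes_{\hat{\mathcal O}_x}K_x)$ be the adelic product over the closed points $x$ of $C$, that is, the space of families whose component at $x$ lies in the image of $\hat{\mathcal F}_x$ for all but finitely many $x$. Put $W=\Gamma(C-P,\mathcal F)$. Then the canonical map $W\to\mathcal F_\eta$ is injective, and the following two complexes of $k$-vector spaces, placed in degrees $0$ and $1$, are quasi-isomorphic: (i) the adelic complex $$\mathcal F_\eta\oplus\prod_{x\in C}\hat{\mathcal F}_x\longrightarrow\prod_{x\in C}{}'\,(\hat{\mathcal F}_x\otimes_{\hat{\mathcal O}_x}K_x),\qquad (a,(b_x)_x)\mapsto(a-b_x)_x;$$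 (ii) the complex $$W\oplus\hat{\mathcal F}_P\longrightarrow\hat{\mathcal F}_P\otimes_{\hat{\mathcal O}_P}K_P,\qquad (w,f)\mapsto w-f.$$ More precisely, the morphism from (ii) to (i) given in degree $0$ by $(w,f)\mapsto(w,(b_x)_x)$ with $b_P=f$ and $b_x=w$ for $x\neq P$, and in degree $1$ by extension by zero from $P$ to all closed points, is a quasi-isomorphism. -/

import Mathlib

open CategoryTheory AlgebraicGeometry TopologicalSpace IsLocalRing
open scoped TensorProduct nonZeroDivisors

universe u

noncomputable section

namespace CurveAdeles

/-! ### Stalks of sheaves of modules -/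

section Stalks

variable {X : Scheme.{u}}

/-- The stalk `F_x` of a sheaf of modules. -/
abbrev Stalk (F : X.Modules) (x : X) : Type u := F.presheaf.stalk x

/-- `F_x` is a module over the local ring `𝒪_x`. -/
instance instModuleStalk (F : X.Modules) (x : X) : Module (X.presheaf.stalk x) (Stalk F x) :=
  PresheafOfModules.instModuleCarrierStalkCommRingCatCarrierAbPresheafOpensCarrier
    (X := X.toPresheafedSpace.carrier) (R := X.presheaf) F.val x

/-- The germ at `x` of a section. -/
def germ (F : X.Modules) (U : X.Opens) (x : X) (hx : x ∈ U) : Γ(F, U) →+ Stalk F x :=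
  (F.presheaf.germ U x hx).hom

theorem germ_smul (F : X.Modules) (U : X.Opens) (x : X) (hx : x ∈ U) (r : Γ(X, U))
    (m : Γ(F, U)) :
    germ F U x hx (r • m) = X.presheaf.germ U x hx r • germ F U x hx m :=
  PresheafOfModules.germ_smul (X := X.toPresheafedSpace.carrier) (R := X.presheaf) F.val x U hx r m

theorem germ_res (F : X.Modules) {U V : X.Opens} (i : U ⟶ V) (x : X) (hx : x ∈ U)
    (m : Γ(F, V)) :
    germ F U x hx (F.presheaf.map i.op m) = germ F V x (i.le hx) m :=
  TopCat.Presheaf.germ_res_apply F.presheaf i x hx m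

/-- The specialization map `F_y → F_x` for `y` in the closure of `x`. -/
def specialize (F : X.Modules) {x y : X} (h : x ⤳ y) : Stalk F y →+ Stalk F x :=
  (F.presheaf.stalkSpecializes h).hom

theorem specialize_germ (F : X.Modules) {x y : X} (h : x ⤳ y) (U : X.Opens) (hy : y ∈ U)
    (m : Γ(F, U)) :
    specialize F h (germ F U y hy m) = germ F U x (h.mem_open U.2 hy) m :=
  TopCat.Presheaf.germ_stalkSpecializes_apply F.presheaf hy h m

theorem exists_germ (F : X.Modules) (x : X) (a : Stalk F x) : ∃ U hx m, germ F U x hx m = a :=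
  F.presheaf.exists_germ_eq a

theorem exists_germ_germ (F : X.Modules) (x : X) (r : X.presheaf.stalk x) (a : Stalk F x) :
    ∃ (U : X.Opens) (hx : x ∈ U) (s : Γ(X, U)) (m : Γ(F, U)),
      X.presheaf.germ U x hx s = r ∧ germ F U x hx m = a := by
  obtain ⟨U, hU, s, rfl⟩ := X.presheaf.exists_germ_eq r
  obtain ⟨V, hV, m, rfl⟩ := exists_germ F x a
  exact ⟨U ⊓ V, ⟨hU, hV⟩, X.presheaf.map (homOfLE inf_le_left).op s,
    F.presheaf.map (homOfLE inf_le_right).op m, TopCat.Presheaf.germ_res_apply .., germ_res ..⟩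

theorem specialize_smul (F : X.Modules) {x y : X} (h : x ⤳ y) (r : X.presheaf.stalk y)
    (a : Stalk F y) :
    specialize F h (r • a) = X.presheaf.stalkSpecializes h r • specialize F h a := by
  obtain ⟨U, hU, s, m, rfl, rfl⟩ := exists_germ_germ F y r a
  rw [← germ_smul, specialize_germ, specialize_germ, germ_smul]
  congr 1
  exact (TopCat.Presheaf.germ_stalkSpecializes_apply X.presheaf _ h _).symm

end Stalks

/-! ### The stalk at the generic point is a localization of every stalk

This is what makes the map `F_η → F̂_x ⊗ K_x` available for a quasi-coherent sheaf. -/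

section Generic

variable {X : Scheme.{u}}

/-- A function on an affine chart, as a section of the structure sheaf. -/
def chartFun {R : CommRingCat.{u}} (j : Spec R ⟶ X) [IsOpenImmersion j] (W : (Spec R).Opens)
    (r : R) : Γ(X, j ''ᵁ W) :=
  (j.appIso W).inv ((Spec R).presheaf.map W.leTop.op ((Scheme.ΓSpecIso R).inv r))

theorem map_chartFun {R : CommRingCat.{u}} (j : Spec R ⟶ X) [IsOpenImmersion j]
    {W V : (Spec R).Opens} (i : W ⟶ V) (r : R) :
    X.presheaf.map (j.opensFunctor.map i).op (chartFun j V r) = chartFun j W r := by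
  have := congr($(j.appIso_inv_naturality i.op)
    ((Spec R).presheaf.map V.leTop.op ((Scheme.ΓSpecIso R).inv r)))
  simp only [ConcreteCategory.comp_apply] at this
  refine this.symm.trans ?_
  unfold chartFun
  congr 1

theorem germ_chartFun {R : CommRingCat.{u}} (j : Spec R ⟶ X) [IsOpenImmersion j]
    {W V : (Spec R).Opens} (h : W ≤ V) (r : R) (x : X) (hx : x ∈ j ''ᵁ W) (hx' : x ∈ j ''ᵁ V) :
    X.presheaf.germ _ x hx (chartFun j W r) = X.presheaf.germ _ x hx' (chartFun j V r) := by
  rw [← map_chartFun j (homOfLE h) r]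
  exact TopCat.Presheaf.germ_res_apply ..

theorem isLocalizing_restrict {R : CommRingCat.{u}} (j : Spec R ⟶ X) [IsOpenImmersion j]
    (F : X.Modules) [F.IsQuasicoherent] :
    IsLocalizing (modulesSpecToSheaf.obj (F.restrict j)) := by
  rw [← isIso_fromTildeΓ_iff_isLocalizing]
  infer_instance

theorem chart_surj {R : CommRingCat.{u}} (j : Spec R ⟶ X) [IsOpenImmersion j] (F : X.Modules)
    [F.IsQuasicoherent] (f : R) (s : Γ(F, j ''ᵁ (PrimeSpectrum.basicOpen f))) :
    ∃ (n : ℕ) (m : Γ(F, j ''ᵁ ⊤)),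
      F.presheaf.map (j.opensFunctor.map (PrimeSpectrum.basicOpen f).leTop).op m =
        chartFun j (PrimeSpectrum.basicOpen f) (f ^ n) • s := by
  obtain ⟨⟨m, _, n, rfl⟩, h⟩ :=
    (isLocalizing_restrict j F f).surj ((F.restrictAppIso j _).inv s)
  exact ⟨n, m, h.symm⟩

theorem chart_inj {R : CommRingCat.{u}} (j : Spec R ⟶ X) [IsOpenImmersion j] (F : X.Modules)
    [F.IsQuasicoherent] (f : R) (m : Γ(F, j ''ᵁ ⊤))
    (hm : F.presheaf.map (j.opensFunctor.map (PrimeSpectrum.basicOpen f).leTop).op m = 0) :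
    ∃ n : ℕ, chartFun j ⊤ (f ^ n) • m = 0 := by
  have H := isLocalizing_restrict j F f
  obtain ⟨⟨_, n, rfl⟩, h⟩ := (IsLocalizedModule.eq_zero_iff (Submonoid.powers f)
    (ModuleCat.Hom.hom ((modulesSpecToSheaf.obj (F.restrict j)).obj.map
      (PrimeSpectrum.basicOpen f).leTop.op))).mp hm
  exact ⟨n, h⟩

theorem chartFun_ne_zero {R : CommRingCat.{u}} (j : Spec R ⟶ X) [IsOpenImmersion j] (r : R)
    (hr : r ≠ 0) : chartFun j ⊤ r ≠ 0 := by
  intro h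
  have h0 : chartFun j ⊤ 0 = 0 := by simp [chartFun]
  have i1 : Function.Injective (j.appIso ⊤).inv :=
    (ConcreteCategory.bijective_of_isIso (j.appIso ⊤).inv).1
  have i2 : Function.Injective (Scheme.ΓSpecIso R).inv :=
    (ConcreteCategory.bijective_of_isIso (Scheme.ΓSpecIso R).inv).1
  have i3 : Function.Injective
      ((Spec R).presheaf.map (Opens.leTop (⊤ : (Spec R).Opens)).op) := by
    have : (Opens.leTop (⊤ : (Spec R).Opens)) = 𝟙 _ := rfl
    rw [this, op_id, CategoryTheory.Functor.map_id]
    exact fun _ _ h => h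
  exact hr (i2 (i3 (i1 (h.trans h0.symm))))

variable [IsIntegral X]

theorem genericPoint_mem (U : X.Opens) (x : X) (hx : x ∈ U) : genericPoint X ∈ U :=
  (genericPoint_specializes x).mem_open U.2 hx

theorem germ_chartFun_ne_zero {R : CommRingCat.{u}} (j : Spec R ⟶ X) [IsOpenImmersion j] (r : R)
    (hr : r ≠ 0) (n : ℕ) (x : X) (hx : x ∈ j ''ᵁ ⊤) :
    X.presheaf.germ _ x hx (chartFun j ⊤ (r ^ n)) ≠ 0 := by
  have : IsDomain R := by
    have : Nonempty (Spec R) := ⟨hx.choose⟩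
    have : AlgebraicGeometry.IsIntegral (Spec R) := isIntegral_of_isOpenImmersion j
    exact (affine_isIntegral_iff R).mp this
  intro h
  exact chartFun_ne_zero j (r ^ n) (pow_ne_zero n hr)
    (germ_injective_of_isIntegral X x hx (h.trans (map_zero _).symm))

theorem exists_basicOpen {R : CommRingCat.{u}} (j : Spec R ⟶ X) [IsOpenImmersion j] (y : Spec R)
    (V : X.Opens) (hV : genericPoint X ∈ V) :
    ∃ f : R, f ≠ 0 ∧ j ''ᵁ (PrimeSpectrum.basicOpen f) ≤ V ∧
      genericPoint X ∈ j ''ᵁ (PrimeSpectrum.basicOpen f) := by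
  have h1 : genericPoint X ∈ j ''ᵁ ⊤ := genericPoint_mem _ (j y) ⟨y, trivial, rfl⟩
  obtain ⟨z, -, hz⟩ := h1
  have hz : j z = genericPoint X := hz
  obtain ⟨_, ⟨_, ⟨f, rfl⟩, rfl⟩, hzf, hf⟩ :=
    PrimeSpectrum.isBasis_basic_opens.exists_subset_of_mem_open
      (show z ∈ (j ⁻¹ᵁ V : Set (Spec R)) from (show j z ∈ V from hz ▸ hV)) (j ⁻¹ᵁ V).2
  refine ⟨f, ?_, ?_, ⟨z, hzf, hz⟩⟩
  · rintro rfl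
    exact hzf (zero_mem _)
  · rintro _ ⟨w, hw, rfl⟩
    exact hf hw

theorem exists_section (F : X.Modules) [F.IsQuasicoherent] (x : X)
    (a : Stalk F (genericPoint X)) :
    ∃ (g : X.presheaf.stalk x) (m : Stalk F x), g ≠ 0 ∧
      specialize F (genericPoint_specializes x) m =
        X.presheaf.stalkSpecializes (genericPoint_specializes x) g • a := by
  obtain ⟨V, hV, s, rfl⟩ := exists_germ F _ a
  obtain ⟨U, hU, hxU, -⟩ := exists_isAffineOpen_mem_and_subset (U := ⊤) (x := x) trivial
  obtain ⟨y, rfl⟩ : ∃ y, hU.fromSpec y = x := hU.range_fromSpec.ge hxU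
  obtain ⟨f, hf0, hfV, hf⟩ := exists_basicOpen hU.fromSpec y V hV
  obtain ⟨n, m, hm⟩ := chart_surj hU.fromSpec F f (F.presheaf.map (homOfLE hfV).op s)
  have hx : hU.fromSpec y ∈ hU.fromSpec ''ᵁ (⊤) := ⟨y, trivial, rfl⟩
  refine ⟨X.presheaf.germ _ _ hx (chartFun hU.fromSpec ⊤ (f ^ n)), germ F _ _ hx m, ?_, ?_⟩
  · exact germ_chartFun_ne_zero _ _ hf0 _ _ _
  · rw [specialize_germ, ← germ_res F (homOfLE hfV) _ hf s]
    have := congr(germ F _ (genericPoint X) hf $hm)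
    rw [germ_smul] at this
    have e := germ_chartFun hU.fromSpec (W := PrimeSpectrum.basicOpen f) le_top (f ^ n) _ hf
      (genericPoint_mem _ _ hx)
    refine Eq.trans ?_ (this.trans ?_)
    · exact (germ_res F _ _ _ _).symm
    · refine congrArg (· • _) (e.trans ?_)
      exact (TopCat.Presheaf.germ_stalkSpecializes_apply X.presheaf _ _ _).symm

theorem exists_smul_eq_zero (F : X.Modules) [F.IsQuasicoherent] (x : X) (a : Stalk F x)
    (ha : specialize F (genericPoint_specializes x) a = 0) :
    ∃ g : X.presheaf.stalk x, g ≠ 0 ∧ g • a = 0 := by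
  obtain ⟨W, hW, s, rfl⟩ := exists_germ F _ a
  obtain ⟨U, hU, hxU, hUW⟩ := exists_isAffineOpen_mem_and_subset hW
  obtain ⟨y, rfl⟩ : ∃ y, hU.fromSpec y = x := hU.range_fromSpec.ge hxU
  have hx : hU.fromSpec y ∈ hU.fromSpec ''ᵁ (⊤) := ⟨y, trivial, rfl⟩
  have hle : hU.fromSpec ''ᵁ ⊤ ≤ W := by
    rintro _ ⟨z, -, rfl⟩
    exact hUW (hU.range_fromSpec.le ⟨z, rfl⟩)
  have hη : genericPoint X ∈ hU.fromSpec ''ᵁ ⊤ := genericPoint_mem _ _ hx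
  set m := F.presheaf.map (homOfLE hle).op s with hmdef
  have e : germ F W _ hW s = germ F _ _ hx m := (germ_res F (homOfLE hle) _ hx s).symm
  rw [e] at ha ⊢
  rw [specialize_germ] at ha
  obtain ⟨V, hV, i1, i2, hi⟩ := TopCat.Presheaf.germ_eq F.presheaf _ hη hη m 0
    (ha.trans (map_zero (germ F _ _ hη)).symm)
  obtain ⟨f, hf0, hfV, hf⟩ := exists_basicOpen hU.fromSpec y V hV
  obtain ⟨n, hn⟩ := chart_inj hU.fromSpec F f m (by
    have := congr(F.presheaf.map (homOfLE hfV).op $hi)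
    rw [map_zero, map_zero, ← ConcreteCategory.comp_apply, ← Functor.map_comp] at this
    exact this)
  refine ⟨X.presheaf.germ _ _ hx (chartFun hU.fromSpec ⊤ (f ^ n)), ?_, ?_⟩
  · exact germ_chartFun_ne_zero _ _ hf0 _ _ _
  · rw [← germ_smul, hn, map_zero]

/-- `F_η` as an `𝒪_x`-module, through `𝒪_x → 𝒪_η`. -/
abbrev genericModule (F : X.Modules) (x : X) :
    Module (X.presheaf.stalk x) (Stalk F (genericPoint X)) :=
  Module.compHom _ (X.presheaf.stalkSpecializes (genericPoint_specializes x)).hom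

/-- The specialization map `F_x → F_η`, as an `𝒪_x`-linear map. -/
def toGeneric (F : X.Modules) (x : X) :
    letI := genericModule F x
    Stalk F x →ₗ[X.presheaf.stalk x] Stalk F (genericPoint X) :=
  letI := genericModule F x
  { specialize F (genericPoint_specializes x) with
    map_smul' := specialize_smul F (genericPoint_specializes x) }

theorem isLocalizedModule_toGeneric (F : X.Modules) [F.IsQuasicoherent] (x : X) :
    letI := genericModule F x
    IsLocalizedModule (X.presheaf.stalk x)⁰ (toGeneric F x) := by
  let := genericModule F x
  have inj : Function.Injective (X.presheaf.stalkSpecializes (genericPoint_specializes x)).hom :=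
    IsFractionRing.injective (X.presheaf.stalk x) X.functionField
  constructor
  · rintro ⟨s, hs⟩
    have hs0 : (X.presheaf.stalkSpecializes (genericPoint_specializes x)).hom s ≠ 0 := fun h =>
      nonZeroDivisors.ne_zero hs (inj (h.trans (map_zero _).symm))
    obtain ⟨t, ht⟩ := (isUnit_iff_ne_zero (G₀ := X.functionField)).mpr hs0
    rw [Module.End.isUnit_iff]
    constructor
    · intro a b hab
      have hab : (t : X.functionField) • a = (t : X.functionField) • b := by
        rw [ht]; exact hab
      have := congrArg (fun z : Stalk F (genericPoint X) => (t⁻¹ : X.functionFieldˣ).1 • z) hab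
      simpa only [smul_smul, Units.inv_mul, one_smul] using this
    · intro b
      refine ⟨(t⁻¹ : X.functionFieldˣ).1 • b, ?_⟩
      change (X.presheaf.stalkSpecializes (genericPoint_specializes x)).hom s •
        ((t⁻¹ : X.functionFieldˣ).1 • b : Stalk F (genericPoint X)) = b
      rw [← ht, smul_smul, Units.mul_inv, one_smul]
  · intro a
    obtain ⟨g, m, hg, hm⟩ := exists_section F x a
    exact ⟨⟨m, g, mem_nonZeroDivisors_of_ne_zero hg⟩, hm.symm⟩
  · intro a b hab
    obtain ⟨g, hg, h⟩ := exists_smul_eq_zero F x (a - b) (by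
      rw [map_sub, sub_eq_zero]; exact hab)
    exact ⟨⟨g, mem_nonZeroDivisors_of_ne_zero hg⟩,
      sub_eq_zero.mp ((smul_sub g a b).symm.trans h)⟩

end Generic

/-! ### Completions of modules over a local ring -/

section Completion

variable (O : Type u) [CommRing O] [IsLocalRing O] (M : Type u) [AddCommGroup M] [Module O M]

/-- The completion `M̂ = lim M / 𝔪ⁿ M` of a module over a local ring. -/
abbrev Hat : Type u := AdicCompletion (maximalIdeal O) M

/-- The total ring of fractions of the completed local ring `Ô`. -/
abbrev HatFrac : Type u := FractionRing (Hat O O)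

/-- The tensor product of `M̂` with the total ring of fractions of `Ô`, over `Ô`. -/
abbrev HatTensor : Type u := HatFrac O ⊗[Hat O O] Hat O M

/-- The canonical map from `M̂` to its tensor product with the total ring of fractions of `Ô`. -/
def ofHat : Hat O M →ₗ[Hat O O] HatTensor O M := TensorProduct.mk _ _ _ 1

instance instIsScalarTowerHat (k : Type u) [CommRing k] [Algebra k O] [Module k M]
    [IsScalarTower k O M] : IsScalarTower k (Hat O O) (Hat O M) :=
  ⟨fun c a m => by rw [← algebraMap_smul O c a, ← algebraMap_smul O c (a • m), smul_assoc]⟩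

theorem isUnit_hatFrac [IsNoetherianRing O] (s : O⁰) : IsUnit (algebraMap O (HatFrac O) s) := by
  rw [IsScalarTower.algebraMap_apply O (Hat O O) (HatFrac O)]
  refine IsLocalization.map_units (M := (Hat O O)⁰) (HatFrac O) ⟨algebraMap O (Hat O O) s, ?_⟩
  have h : IsSMulRegular (Hat O O) (s : O) := Module.Flat.isSMulRegular_of_nonZeroDivisors s.2
  rw [mem_nonZeroDivisors_iff_right]
  intro z hz
  refine h ?_
  simp only [smul_zero]
  rw [Algebra.smul_def, mul_comm, hz]

variable {O M}

/-- The unique `O`-linear map extending `M → M̂ → M̂ ⊗ Frac Ô` to a localization `N` of `M` at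
the nonzerodivisors of `O`. -/
def liftGeneric [IsNoetherianRing O] {N : Type u} [AddCommGroup N] [Module O N] (l : M →ₗ[O] N)
    (hl : IsLocalizedModule O⁰ l) : N →ₗ[O] HatTensor O M :=
  IsLocalizedModule.lift O⁰ l
    ((ofHat O M).restrictScalars O ∘ₗ AdicCompletion.of (maximalIdeal O) M) fun s => by
      have := (isUnit_hatFrac O s).map
        (algebraMap (HatFrac O) (Module.End (HatFrac O) (HatTensor O M)))
      rw [Module.End.isUnit_iff] at this ⊢
      convert this using 1
      ext z
      simp

theorem liftGeneric_apply [IsNoetherianRing O] {N : Type u} [AddCommGroup N] [Module O N]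
    (l : M →ₗ[O] N) (hl : IsLocalizedModule O⁰ l) (m : M) :
    liftGeneric l hl (l m) = ofHat O M (AdicCompletion.of (maximalIdeal O) M m) :=
  IsLocalizedModule.lift_apply ..

end Completion

/-- The restricted product of a family of modules `M_i` with respect to submodules `N_i`: the
families `(a_i)` with `a_i ∈ N_i` for all but finitely many `i`. -/
def restrictedProduct {ι k : Type*} [Semiring k] {M : ι → Type*} [∀ i, AddCommMonoid (M i)]
    [∀ i, Module k (M i)] (N : ∀ i, Submodule k (M i)) : Submodule k (∀ i, M i) where
  carrier := {a | {i | a i ∉ N i}.Finite}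
  add_mem' {a b} ha hb := (Set.Finite.union ha hb).subset fun i h => by
    by_contra h'
    simp only [Set.mem_union, Set.mem_ofPred_eq, not_or, not_not] at h'
    exact h (Submodule.add_mem _ h'.1 h'.2)
  zero_mem' := Set.finite_empty.subset fun i h => h (Submodule.zero_mem (N i))
  smul_mem' c _ ha := Set.Finite.subset ha fun _ h h' => h (Submodule.smul_mem _ c h')

/-! ### Projective curves -/

section ProjectiveSpace

attribute [local instance] MvPolynomial.gradedAlgebra

/-- Projective `n`-space `Proj k[x₀, …, xₙ]` over a field. -/
abbrev ProjSpace (n : ℕ) (k : Type u) [Field k] : Scheme.{u} :=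
  Proj (MvPolynomial.homogeneousSubmodule (Fin (n + 1)) k)

/-- The structure morphism of projective space. -/
def ProjSpace.str (n : ℕ) (k : Type u) [Field k] : ProjSpace n k ⟶ Spec (.of k) :=
  Proj.toSpecZero _ ≫ Spec.map (CommRingCat.ofHom
    (algebraMap k (MvPolynomial.homogeneousSubmodule (Fin (n + 1)) k 0)))

instance (n : ℕ) (k : Type u) [Field k] : Algebra.FiniteType
    (MvPolynomial.homogeneousSubmodule (Fin (n + 1)) k 0) (MvPolynomial (Fin (n + 1)) k) :=
  have : IsScalarTower k (MvPolynomial.homogeneousSubmodule (Fin (n + 1)) k 0)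
      (MvPolynomial (Fin (n + 1)) k) := ⟨fun c a p => Algebra.smul_mul_assoc c a.1 p⟩
  Algebra.FiniteType.of_restrictScalars_finiteType k _ _

instance (n : ℕ) (k : Type u) [Field k] : LocallyOfFiniteType (ProjSpace.str n k) := by
  have : LocallyOfFiniteType (Spec.map (CommRingCat.ofHom
      (algebraMap k (MvPolynomial.homogeneousSubmodule (Fin (n + 1)) k 0)))) := by
    rw [HasRingHomProperty.Spec_iff (P := @LocallyOfFiniteType)]
    refine RingHom.FiniteType.of_surjective _ ?_
    rintro ⟨p, hp⟩
    rw [MvPolynomial.homogeneousSubmodule_zero, Submodule.mem_one] at hp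
    obtain ⟨c, hc⟩ := hp
    exact ⟨c, Subtype.ext hc⟩
  unfold ProjSpace.str
  infer_instance

instance (n : ℕ) (k : Type u) [Field k] : QuasiCompact (ProjSpace.str n k) := by
  unfold ProjSpace.str
  infer_instance

end ProjectiveSpace

/-- A projective curve over a field `k`: an integral `k`-scheme of dimension one which is
isomorphic over `k` to a closed subscheme of a projective space. -/
structure ProjectiveCurve (k : Type u) [Field k] where
  /-- The underlying scheme. -/
  scheme : Scheme.{u}
  /-- The structure morphism. -/
  str : scheme ⟶ Spec (.of k)
  isIntegral : IsIntegral scheme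
  dim_eq_one : topologicalKrullDim scheme = 1
  projective : ∃ (n : ℕ) (i : scheme ⟶ ProjSpace n k),
    IsClosedImmersion i ∧ i ≫ ProjSpace.str n k = str

namespace ProjectiveCurve

section Points

variable {k : Type u} [Field k] (C : ProjectiveCurve k)

instance : IsIntegral C.scheme := C.isIntegral

instance : LocallyOfFiniteType C.str := by
  obtain ⟨n, i, hi, h⟩ := C.projective
  rw [← h]
  infer_instance

instance : QuasiCompact C.str := by
  obtain ⟨n, i, hi, h⟩ := C.projective
  rw [← h]
  infer_instance

instance : CompactSpace C.scheme := QuasiCompact.compactSpace_of_compactSpace C.str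

instance : IsNoetherian C.scheme where
  toIsLocallyNoetherian := LocallyOfFiniteType.isLocallyNoetherian C.str

/-- The generic point. -/
abbrev η : C.scheme := genericPoint C.scheme

/-- The closed points of the curve. -/
abbrev ClosedPoint : Type u := {x : C.scheme // IsClosed ({x} : Set C.scheme)}

theorem eq_of_mem_irreducible (T : Set C.scheme) (hT : IsIrreducible T) (hTc : IsClosed T)
    (hne : T ≠ Set.univ) (x : C.ClosedPoint) (hx : x.1 ∈ T) : T = {x.1} := by
  by_contra h
  let a : IrreducibleCloseds C.scheme := ⟨{x.1}, isIrreducible_singleton, x.2⟩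
  let b : IrreducibleCloseds C.scheme := ⟨T, hT, hTc⟩
  let c : IrreducibleCloseds C.scheme :=
    ⟨Set.univ, IrreducibleSpace.isIrreducible_univ _, isClosed_univ⟩
  have hab : a < b := lt_of_le_of_ne (Set.singleton_subset_iff.mpr hx)
    fun e => h (congrArg (fun s : IrreducibleCloseds C.scheme => (s : Set C.scheme)) e).symm
  have hbc : b < c := lt_of_le_of_ne (Set.subset_univ _)
    fun e => hne (congrArg (fun s : IrreducibleCloseds C.scheme => (s : Set C.scheme)) e)
  let p : LTSeries (IrreducibleCloseds C.scheme) := ⟨2, ![a, b, c], fun i => by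
    fin_cases i
    exacts [hab, hbc]⟩
  have := Order.LTSeries.length_le_krullDim p
  have h1 : Order.krullDim (IrreducibleCloseds C.scheme) = 1 := C.dim_eq_one
  rw [h1] at this
  have : (2 : WithBot ℕ∞) ≤ 1 := this
  exact absurd this (by decide)

theorem finite_closedPoints (V : C.scheme.Opens) (hV : C.η ∈ V) :
    {x : C.ClosedPoint | x.1 ∉ V}.Finite := by
  obtain ⟨S, hS, hSc, hSi, hSu⟩ := NoetherianSpace.exists_finite_set_isClosed_irreducible
    V.2.isClosed_compl
  refine Set.Finite.of_finite_image (f := fun x : C.ClosedPoint => ({x.1} : Set C.scheme))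
    (hS.subset ?_) fun x _ y _ h => Subtype.ext (Set.singleton_injective h)
  rintro _ ⟨x, hx, rfl⟩
  obtain ⟨T, hT, hxT⟩ : x.1 ∈ ⋃₀ S := hSu ▸ hx
  have := C.eq_of_mem_irreducible T (hSi T hT) (hSc T hT) (by
    rintro rfl
    exact (show C.η ∈ (V : Set C.scheme)ᶜ from hSu ▸ ⟨_, hT, trivial⟩) hV) x hxT
  change {x.1} ∈ S
  rwa [← this]

theorem not_isClosed_η : ¬ IsClosed ({C.η} : Set C.scheme) := by
  intro h
  have h1 : ({C.η} : Set C.scheme) = Set.univ :=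
    h.closure_eq.symm.trans (genericPoint_spec C.scheme)
  have : Subsingleton C.scheme := Set.subsingleton_univ_iff.mp (h1 ▸ Set.subsingleton_singleton)
  have h2 := topologicalKrullDim_zero_of_discreteTopology C.scheme
  rw [C.dim_eq_one] at h2
  exact absurd h2 (by decide)

/-- The open set `C - P`. -/
def punctured (P : C.ClosedPoint) : C.scheme.Opens := ⟨{P.1}ᶜ, P.2.isOpen_compl⟩

theorem η_mem_punctured (P : C.ClosedPoint) : C.η ∈ C.punctured P := fun h =>
  C.not_isClosed_η ((show C.η = P.1 from h) ▸ P.2)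

end Points

/-! ### The `k`-linear structures -/

section Linear

variable {k : Type u} [Field k] (C : ProjectiveCurve k)

instance (U : C.scheme.Opens) : Algebra k Γ(C.scheme, U) :=
  (CommRingCat.Hom.hom ((Scheme.ΓSpecIso (.of k)).inv ≫ C.str.appTop ≫
    C.scheme.presheaf.map U.leTop.op)).toAlgebra

instance (x : C.scheme) : Algebra k (C.scheme.presheaf.stalk x) :=
  ((C.scheme.presheaf.germ ⊤ x trivial).hom.comp (algebraMap k Γ(C.scheme, ⊤))).toAlgebra

theorem algebraMap_stalk (U : C.scheme.Opens) (x : C.scheme) (hx : x ∈ U) (c : k) :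
    algebraMap k (C.scheme.presheaf.stalk x) c =
      C.scheme.presheaf.germ U x hx (algebraMap k Γ(C.scheme, U) c) := by
  change C.scheme.presheaf.germ ⊤ x trivial (C.scheme.presheaf.map (⊤ : C.scheme.Opens).leTop.op
      (C.str.appTop ((Scheme.ΓSpecIso (.of k)).inv c))) =
    C.scheme.presheaf.germ U x hx (C.scheme.presheaf.map U.leTop.op
      (C.str.appTop ((Scheme.ΓSpecIso (.of k)).inv c)))
  exact (TopCat.Presheaf.germ_res_apply C.scheme.presheaf _ _ _ _).trans
    (TopCat.Presheaf.germ_res_apply C.scheme.presheaf _ _ _ _).symm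

theorem specializes_algebraMap {x y : C.scheme} (h : x ⤳ y) (c : k) :
    (C.scheme.presheaf.stalkSpecializes h).hom (algebraMap k (C.scheme.presheaf.stalk y) c) =
      algebraMap k (C.scheme.presheaf.stalk x) c := by
  rw [C.algebraMap_stalk ⊤ y trivial, C.algebraMap_stalk ⊤ x trivial]
  exact TopCat.Presheaf.germ_stalkSpecializes_apply C.scheme.presheaf _ h _

variable (F : C.scheme.Modules)

instance (U : C.scheme.Opens) : Module k Γ(F, U) :=
  Module.compHom _ (algebraMap k Γ(C.scheme, U))

instance (x : C.scheme) : Module k (Stalk F x) :=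
  Module.compHom _ (algebraMap k (C.scheme.presheaf.stalk x))

instance (x : C.scheme) : IsScalarTower k (C.scheme.presheaf.stalk x) (Stalk F x) :=
  .of_algebraMap_smul fun _ _ => rfl

/-- The `k`-linear germ map `Γ(U, F) → F_x`. -/
def germₗ (U : C.scheme.Opens) (x : C.scheme) (hx : x ∈ U) : Γ(F, U) →ₗ[k] Stalk F x :=
  { germ F U x hx with
    map_smul' := fun c m =>
      (germ_smul F U x hx (algebraMap k Γ(C.scheme, U) c) m).trans
        (congrArg (· • germ F U x hx m) (C.algebraMap_stalk U x hx c).symm) }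

/-- The completed stalk `F̂_x`. -/
abbrev completedStalk (x : C.scheme) : Type u := Hat (C.scheme.presheaf.stalk x) (Stalk F x)

/-- `F̂_x ⊗ K_x`, the tensor product over `Ô_x`, with `K_x` the total ring of fractions of
`Ô_x`. -/
abbrev completedStalkTensor (x : C.scheme) : Type u :=
  HatTensor (C.scheme.presheaf.stalk x) (Stalk F x)

instance (x : C.scheme) : AddCommGroup (C.completedStalkTensor F x) :=
  TensorProduct.addCommGroup

instance (x : C.scheme) : Module k (C.completedStalkTensor F x) :=
  TensorProduct.leftModule

/-- The map `F_x → F̂_x`. -/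
def toCompletedStalk (x : C.scheme) : Stalk F x →ₗ[k] C.completedStalk F x :=
  (AdicCompletion.of (maximalIdeal (C.scheme.presheaf.stalk x)) (Stalk F x)).restrictScalars k

/-- The map `F̂_x → F̂_x ⊗ K_x`. -/
def integral (x : C.scheme) : C.completedStalk F x →ₗ[k] C.completedStalkTensor F x :=
  (ofHat (C.scheme.presheaf.stalk x) (Stalk F x)).restrictScalars k

/-- The map `F_η → F̂_x ⊗ K_x`: the stalk `F_η` is the localization of `F_x` at the nonzero
elements of `𝒪_x`, and this map is the unique `𝒪_x`-linear extension of
`F_x → F̂_x → F̂_x ⊗ K_x`. -/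
def rational [F.IsQuasicoherent] (x : C.scheme) :
    Stalk F C.η →ₗ[k] C.completedStalkTensor F x :=
  letI := genericModule F x
  haveI : IsScalarTower k (C.scheme.presheaf.stalk x) (Stalk F C.η) :=
    .of_algebraMap_smul fun c m => congrArg (fun r : C.scheme.presheaf.stalk C.η => r • m)
      (C.specializes_algebraMap (genericPoint_specializes x) c)
  (liftGeneric (toGeneric F x) (isLocalizedModule_toGeneric F x)).restrictScalars k

theorem rational_germ [F.IsQuasicoherent] (U : C.scheme.Opens) (x : C.scheme) (hx : x ∈ U)
    (hη : C.η ∈ U) (m : Γ(F, U)) :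
    C.rational F x (C.germₗ F U C.η hη m) =
      C.integral F x (C.toCompletedStalk F x (C.germₗ F U x hx m)) := by
  let := genericModule F x
  have h : toGeneric F x (germ F U x hx m) = germ F U C.η hη m := specialize_germ F _ U hx m
  change liftGeneric (toGeneric F x) (isLocalizedModule_toGeneric F x) (germ F U C.η hη m) = _
  rw [← h]
  exact liftGeneric_apply (toGeneric F x) (isLocalizedModule_toGeneric F x) (germ F U x hx m)

end Linear

/-! ### The two complexes -/

section Complexes

variable {k : Type u} [Field k] (C : ProjectiveCurve k) (F : C.scheme.Modules)

/-- The adelic product of the `F̂_x ⊗ K_x` over the closed points: the families that lie in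
the image of `F̂_x` for all but finitely many `x`. -/
def adeles : Submodule k (∀ x : C.ClosedPoint, C.completedStalkTensor F x.1) :=
  restrictedProduct fun x => LinearMap.range (C.integral F x.1)

/-- The map from `F_η ⊕ ∏ F̂_x` to the full product of the `F̂_x ⊗ K_x` which sends
`(a, (b_x))` to `(a - b_x)`. -/
def differences [F.IsQuasicoherent] :
    (Stalk F C.η × ∀ x : C.ClosedPoint, C.completedStalk F x.1) →ₗ[k]
      (∀ x : C.ClosedPoint, C.completedStalkTensor F x.1) :=
  LinearMap.pi fun x => (C.rational F x.1).coprod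
    (-(C.integral F x.1 ∘ₗ LinearMap.proj x))

theorem differences_apply [F.IsQuasicoherent]
    (p : Stalk F C.η × ∀ x : C.ClosedPoint, C.completedStalk F x.1) (x : C.ClosedPoint) :
    C.differences F p x = C.rational F x.1 p.1 - C.integral F x.1 (p.2 x) := by
  simp [differences, sub_eq_add_neg]

theorem differences_mem [F.IsQuasicoherent]
    (p : Stalk F C.η × ∀ x : C.ClosedPoint, C.completedStalk F x.1) :
    C.differences F p ∈ C.adeles F := by
  obtain ⟨U, hU, m, hm⟩ := exists_germ F _ p.1
  refine (C.finite_closedPoints U hU).subset fun x hx hxU => hx ?_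
  change C.differences F p x ∈ LinearMap.range (C.integral F x.1)
  rw [differences_apply]
  refine Submodule.sub_mem _ ⟨C.toCompletedStalk F x.1 (C.germₗ F U x.1 hxU m), ?_⟩ ⟨_, rfl⟩
  rw [← C.rational_germ F U x.1 hxU hU m]
  exact congrArg _ hm

/-- The differential of the adelic complex. -/
def adelicDifferential [F.IsQuasicoherent] :
    (Stalk F C.η × ∀ x : C.ClosedPoint, C.completedStalk F x.1) →ₗ[k] C.adeles F :=
  (C.differences F).codRestrict (C.adeles F) (C.differences_mem F)

variable (P : C.ClosedPoint)

/-- The differential `W ⊕ F̂_P → F̂_P ⊗ K_P`, `(w, f) ↦ w - f`, where `W = Γ(C - P, F)` is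
mapped to `F̂_P ⊗ K_P` through `F_η`. -/
def puncturedDifferential [F.IsQuasicoherent] :
    (Γ(F, C.punctured P) × C.completedStalk F P.1) →ₗ[k] C.completedStalkTensor F P.1 :=
  (C.rational F P.1 ∘ₗ C.germₗ F (C.punctured P) C.η (C.η_mem_punctured P)).coprod
    (-C.integral F P.1)

theorem puncturedDifferential_apply [F.IsQuasicoherent]
    (p : Γ(F, C.punctured P) × C.completedStalk F P.1) :
    C.puncturedDifferential F P p =
      C.rational F P.1 (C.germₗ F (C.punctured P) C.η (C.η_mem_punctured P) p.1) -
        C.integral F P.1 p.2 := by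
  simp [puncturedDifferential, sub_eq_add_neg]

open scoped Classical in
/-- The family in `∏ F̂_x` with component `f` at `P` and the germ of `w` at `x ≠ P`. -/
def localComponents (x : C.ClosedPoint) :
    (Γ(F, C.punctured P) × C.completedStalk F P.1) →ₗ[k] C.completedStalk F x.1 :=
  if h : x.1 ∈ C.punctured P then
    C.toCompletedStalk F x.1 ∘ₗ C.germₗ F (C.punctured P) x.1 h ∘ₗ LinearMap.fst k _ _
  else LinearMap.proj x ∘ₗ LinearMap.single k (fun y : C.ClosedPoint => C.completedStalk F y.1) P
    ∘ₗ LinearMap.snd k _ _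

/-- The map `W ⊕ F̂_P → F_η ⊕ ∏ F̂_x` which sends `(w, f)` to `w` in `F_η`, `f` in `F̂_P`, and
`w` in `F̂_x` for `x ≠ P`. -/
def comparisonZero : (Γ(F, C.punctured P) × C.completedStalk F P.1) →ₗ[k]
    (Stalk F C.η × ∀ x : C.ClosedPoint, C.completedStalk F x.1) :=
  (C.germₗ F (C.punctured P) C.η (C.η_mem_punctured P) ∘ₗ LinearMap.fst k _ _).prod
    (LinearMap.pi (C.localComponents F P))

open scoped Classical in
theorem single_mem (z : C.completedStalkTensor F P.1) :
    LinearMap.single k (fun x : C.ClosedPoint => C.completedStalkTensor F x.1) P z ∈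
      C.adeles F := by
  refine (Set.finite_singleton P).subset fun x hx => ?_
  by_contra h
  refine hx ?_
  change LinearMap.single k (fun x : C.ClosedPoint => C.completedStalkTensor F x.1) P z x ∈
    LinearMap.range (C.integral F x.1)
  rw [LinearMap.single_apply, Pi.single_eq_of_ne h]
  exact Submodule.zero_mem _

open scoped Classical in
/-- The inclusion of `F̂_P ⊗ K_P` into the adeles, with zero components at all `x ≠ P`. -/
def comparisonOne : C.completedStalkTensor F P.1 →ₗ[k] C.adeles F :=
  (LinearMap.single k (fun x : C.ClosedPoint => C.completedStalkTensor F x.1) P).codRestrict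
    (C.adeles F) (C.single_mem F P)

theorem comparison_comm [F.IsQuasicoherent] : C.adelicDifferential F ∘ₗ C.comparisonZero F P =
    C.comparisonOne F P ∘ₗ C.puncturedDifferential F P := by
  classical
  refine LinearMap.ext fun p => Subtype.ext (funext fun x => ?_)
  change C.differences F (C.comparisonZero F P p) x =
    (Pi.single (M := fun x : C.ClosedPoint => C.completedStalkTensor F x.1) P
      (C.puncturedDifferential F P p) : ∀ x : C.ClosedPoint, C.completedStalkTensor F x.1) x
  rw [differences_apply]
  change C.rational F x.1 (C.germₗ F (C.punctured P) C.η (C.η_mem_punctured P) p.1) -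
    C.integral F x.1 (C.localComponents F P x p) = _
  by_cases h : x.1 ∈ C.punctured P
  · have hx : x ≠ P := fun e => h (congrArg Subtype.val e)
    rw [Pi.single_eq_of_ne hx, C.rational_germ F (C.punctured P) x.1 h]
    simp [localComponents, h]
  · obtain rfl : x = P := Subtype.ext (not_not.mp h)
    rw [Pi.single_eq_same, puncturedDifferential_apply]
    simp [localComponents, h]

end Complexes

end ProjectiveCurve

/-- The complex `A → B`, with `A` in degree `0` and `B` in degree `1`. -/
def twoTermComplex {k : Type u} [Field k] {A B : Type u} [AddCommGroup A] [Module k A]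
    [AddCommGroup B] [Module k B] (d : A →ₗ[k] B) : CochainComplex (ModuleCat.{u} k) ℤ :=
  HomologicalComplex.double (ModuleCat.ofHom d) (show (ComplexShape.up ℤ).Rel 0 1 from rfl)

/-- The morphism of two-term complexes given by a commutative square. -/
def twoTermMap {k : Type u} [Field k] {A B A' B' : Type u} [AddCommGroup A] [Module k A]
    [AddCommGroup B] [Module k B] [AddCommGroup A'] [Module k A']
    [AddCommGroup B'] [Module k B'] (d : A →ₗ[k] B) (d' : A' →ₗ[k] B') (f : A →ₗ[k] A')
    (g : B →ₗ[k] B') (h : d' ∘ₗ f = g ∘ₗ d) : twoTermComplex d ⟶ twoTermComplex d' :=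
  HomologicalComplex.mkHomFromDouble _ zero_ne_one
    (ModuleCat.ofHom f ≫ (HomologicalComplex.doubleXIso₀ _ _).inv)
    (ModuleCat.ofHom g ≫ (HomologicalComplex.doubleXIso₁ _ _ zero_ne_one).inv)
    (by
      unfold twoTermComplex
      rw [HomologicalComplex.double_d _ _ zero_ne_one]
      simp only [Category.assoc, Iso.inv_hom_id_assoc]
      rw [← Category.assoc, ← Category.assoc, ← ModuleCat.ofHom_comp, ← ModuleCat.ofHom_comp, h])
    (fun n hn => by
      unfold twoTermComplex
      rw [HomologicalComplex.double_d_eq_zero₀ _ _ _ _ one_ne_zero, Limits.comp_zero])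

namespace ProjectiveCurve

variable {k : Type u} [Field k] (C : ProjectiveCurve k) (F : C.scheme.Modules)
  [F.IsQuasicoherent]

/-- The adelic complex `F_η ⊕ ∏ F̂_x → ∏ (F̂_x ⊗ K_x)`. -/
def adelicComplex : CochainComplex (ModuleCat.{u} k) ℤ :=
  twoTermComplex (C.adelicDifferential F)

/-- The complex `W ⊕ F̂_P → F̂_P ⊗ K_P`, where `W = Γ(C - P, F)`. -/
def puncturedComplex (P : C.ClosedPoint) : CochainComplex (ModuleCat.{u} k) ℤ :=
  twoTermComplex (C.puncturedDifferential F P)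

/-- The canonical morphism from the complex `W ⊕ F̂_P → F̂_P ⊗ K_P` to the adelic complex. -/
def comparison (P : C.ClosedPoint) : C.puncturedComplex F P ⟶ C.adelicComplex F :=
  twoTermMap _ _ (C.comparisonZero F P) (C.comparisonOne F P) (C.comparison_comm F P)

end ProjectiveCurve

/-- A sheaf of modules of finite presentation is quasi-coherent. -/
instance {X : Scheme.{u}} (F : X.Modules) [F.IsFinitePresentation] : F.IsQuasicoherent where
  nonempty_quasicoherentData :=
    ⟨(SheafOfModules.IsFinitePresentation.exists_quasicoherentData F).choose⟩

/-- A sheaf of modules is torsion-free if all its stalks are. -/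
def IsTorsionFree {X : Scheme.{u}} (F : X.Modules) : Prop :=
  ∀ x : X, Module.IsTorsionFree (X.presheaf.stalk x) (Stalk F x)

end CurveAdeles

end

/-!
# The adelic complex of a curve and a closed point

The morphism of complexes is bijective on kernels and injective on cokernels by gluing. Let `F` be
coherent and torsion-free. Its stalks embed into the generic stalk `F_η`, and an element of `F_η`
which comes from all stalks over an open set `U` is a section over `U` (`exists_germ_η_eq`). In
the local rings of a curve, an element of `F_η` which is integral in the completion at `x` comes
from the stalk at `x` (`exists_eq_of_liftGeneric_eq`), by Krull's intersection theorem. So an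
element of `F_η` whose images are integral in all completions outside of `P` belongs to
`Γ(C - P, F)`.

Surjectivity on cokernels says that an adele, up to an integral one, is rational outside of `P`.
As `F_η` is dense in the completed generic stalk at `x` (`exists_eq_liftGeneric_add`), this is a
statement about families of elements of `F_η`: strong approximation away from `P`
(`exists_approx`). Both facts on completions need that every nonzerodivisor of the completed local
ring divides a power of an element of the local ring (`exists_mul_eq_pow`). This follows from
Krull's Hauptidealsatz, and holds at singular points as well.

Strong approximation away from `P` is the vanishing of `H¹(C - P, F)`. It is first proved for the
structure sheaf, with the local rings as subrings of the function field `K`: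

* The curve is covered by two affine charts, the loci where two homogeneous functions do not
  vanish (`exists_charts`). Approximation holds on each chart by the Chinese remainder theorem
  (`approx_affine`).
* The quotient `y` of powers of these functions lives on the second chart and has poles at the
  points outside. By the valuative criterion of properness the functions on that chart are
  integral over `k[y]`, hence a finite module (`exists_finset_span`). It follows that the families
  of elements of `K` which are integral almost everywhere, modulo those which are everywhere
  congruent to one element of `K`, form a finite-dimensional space (`exists_finiteDimensional`).
* Therefore some polynomial in the inverse of a nonunit at `P` is the principal part of a function
  `f` with its only pole at `P`, and `f` is transcendental over `k` (`exists_transcendental`).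
* Outside of `P` the corresponding quotient is finite-dimensional too, and `f` acts on it. So it is
  killed by a nonzero polynomial in `f`. Multiplication by that polynomial is bijective on
  almost integral families, so the quotient is zero (`approx_compl`).

For a sheaf `F`, a principal part is multiplied by a rational function which is congruent to `1` to
high order at one point and vanishes to high order at finitely many others (`exists_approx_module`).
-/

noncomputable section

namespace CurveAdeles

/-! ### Approximation by elements of a field -/

section Approximation

open Polynomial

variable {k K ι : Type*} [Field k] [Field K] [Algebra k K]

/-- An element `t` of a subring `A` of a field *vanishes* if inverting `t` turns `A` into the whole
field. If `A` is a one-dimensional local ring, these are the elements of the maximal ideal. -/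
def Vanishes (A : Subalgebra k K) (t : K) : Prop := t ∈ A ∧ ∀ c : K, ∃ n : ℕ, t ^ n * c ∈ A

theorem Vanishes.mul_right {A : Subalgebra k K} {s t : K} (ht : Vanishes A t) (hs : s ∈ A) :
    Vanishes A (t * s) := by
  refine ⟨A.mul_mem ht.1 hs, fun c => ?_⟩
  obtain ⟨n, hn⟩ := ht.2 c
  refine ⟨n, ?_⟩
  have : (t * s) ^ n * c = s ^ n * (t ^ n * c) := by ring
  exact this ▸ A.mul_mem (pow_mem hs n) hn

theorem Vanishes.exists_forall {A : Subalgebra k K} {t : K} (ht : Vanishes A t) (c : K) :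
    ∃ N : ℕ, ∀ n ≥ N, t ^ n * c ∈ A := by
  obtain ⟨N, hN⟩ := ht.2 c
  refine ⟨N, fun n hn => ?_⟩
  obtain ⟨m, rfl⟩ := Nat.exists_eq_add_of_le hn
  have : t ^ (N + m) * c = t ^ m * (t ^ N * c) := by ring
  exact this ▸ A.mul_mem (pow_mem ht.1 m) hN

variable (O : ι → Subalgebra k K)

/-- Strong approximation on the set `S`: every principal part at one point of `S` is the principal
part of an element of `K` which is integral at the other points of `S`. -/
def Approx (S : Set ι) : Prop :=
  ∀ x ∈ S, ∀ c : K, ∃ a : K, a - c ∈ O x ∧ ∀ y ∈ S, y ≠ x → a ∈ O y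

/-- The families of elements of `K` which are approximated on `S` by a single element of `K`. -/
def approximable (S : Set ι) : Submodule k (ι → K) where
  carrier := {v | ∃ a : K, ∀ x ∈ S, v x - a ∈ O x}
  add_mem' := by
    rintro v w ⟨a, ha⟩ ⟨b, hb⟩
    exact ⟨a + b, fun x hx => by
      simpa [add_sub_add_comm] using (O x).add_mem (ha x hx) (hb x hx)⟩
  zero_mem' := ⟨0, fun x _ => by simp⟩
  smul_mem' := by
    rintro c v ⟨a, ha⟩
    exact ⟨c • a, fun x hx => by simpa [smul_sub] using (O x).smul_mem (ha x hx) c⟩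

/-- The families of elements of `K` which are integral at almost all indices. -/
abbrev almostIntegral : Submodule k (ι → K) :=
  restrictedProduct fun x => Subalgebra.toSubmodule (O x)

variable {O}

theorem approximable_anti {S T : Set ι} (h : S ⊆ T) : approximable O T ≤ approximable O S :=
  fun _ ⟨a, ha⟩ => ⟨a, fun x hx => ha x (h hx)⟩

theorem approx_of_le_approximable {S : Set ι} (h : almostIntegral O ≤ approximable O S) :
    Approx O S := by
  classical
  intro x hx c
  obtain ⟨a, ha⟩ := @h (Pi.single x c) ((Set.finite_singleton x).subset fun y hy => by
    by_contra hne
    refine hy ?_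
    rw [Pi.single_eq_of_ne hne]
    exact zero_mem _)
  refine ⟨a, ?_, fun y hy hne => ?_⟩
  · simpa using (O x).neg_mem (ha x hx)
  · have := (O y).neg_mem (ha y hy)
    rwa [Pi.single_eq_of_ne hne, zero_sub, neg_neg] at this

theorem Approx.almostIntegral_le {S : Set ι} (h : Approx O S) :
    almostIntegral O ≤ approximable O S := by
  classical
  intro v hv
  choose! a ha ha' using h
  let T : Finset ι := (Set.Finite.toFinset hv).filter (· ∈ S)
  have hT : ∀ x ∈ T, x ∈ S := fun x hx => (Finset.mem_filter.mp hx).2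
  refine ⟨∑ x ∈ T, a x (v x), fun x hx => ?_⟩
  by_cases hxT : x ∈ T
  · rw [← Finset.add_sum_erase T _ hxT, ← sub_sub]
    refine (O x).sub_mem ?_ (sum_mem fun y hy => ?_)
    · simpa using (O x).neg_mem (ha x hx (v x))
    · exact ha' y (hT y (Finset.mem_of_mem_erase hy)) _ x hx (Finset.ne_of_mem_erase hy).symm
  · have hvx : v x ∈ O x := by
      by_contra hvx
      exact hxT (Finset.mem_filter.mpr ⟨(Set.Finite.mem_toFinset hv).mpr hvx, hx⟩)
    exact (O x).sub_mem hvx (sum_mem fun y hy =>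
      ha' y (hT y hy) _ x hx fun e => hxT (e ▸ hy))

/-- If the points of `S` can be separated by elements which are integral on `S`, then strong
approximation holds on `S`. This is the case of an affine curve. -/
theorem approx_of_separation {S : Set ι} (hfin : ∀ a : K, {x | a ∉ O x}.Finite)
    (hsep : ∀ x ∈ S, ∀ T : Finset ι, (∀ y ∈ T, y ∈ S) → x ∉ T →
      ∃ g : K, (∀ y ∈ S, g ∈ O y) ∧ (∀ y ∈ T, Vanishes (O y) g) ∧ Vanishes (O x) (1 - g)) :
    Approx O S := by
  classical
  intro x hx c
  let T : Finset ι := (hfin c).toFinset.filter fun y => y ∈ S ∧ y ≠ x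
  have hT : ∀ y, y ∈ T ↔ c ∉ O y ∧ y ∈ S ∧ y ≠ x := fun y => by simp [T]
  obtain ⟨g, hg, hgT, hgx⟩ := hsep x hx T (fun y hy => ((hT y).mp hy).2.1)
    fun h => ((hT x).mp h).2.2 rfl
  choose! n hn using fun y hy => (hgT y hy).exists_forall c
  -- For large `N` and `m`, the factor `1 - (1 - g ^ N) ^ m` is close to `1` at `x` and divisible
  -- by `g ^ N`, hence close to `0` on `T`.
  let N := T.sup n
  have hN : ∀ y ∈ T, g ^ N * c ∈ O y := fun y hy => hn y hy N (Finset.le_sup hy)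
  have hvan : Vanishes (O x) (1 - g ^ N) := by
    rw [← mul_neg_geom_sum]
    exact hgx.mul_right (sum_mem fun i _ => pow_mem (hg x hx) i)
  obtain ⟨m, hm⟩ := hvan.2 c
  refine ⟨(1 - (1 - g ^ N) ^ m) * c, ?_, fun y hy hne => ?_⟩
  · have : (1 - (1 - g ^ N) ^ m) * c - c = -((1 - g ^ N) ^ m * c) := by ring
    exact this ▸ (O x).neg_mem hm
  · have hgy : g ^ N ∈ O y := pow_mem (hg y hy) N
    have hs : ∑ i ∈ Finset.range m, (1 - g ^ N) ^ i ∈ O y :=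
      sum_mem fun i _ => pow_mem ((O y).sub_mem (O y).one_mem hgy) i
    have : (1 - (1 - g ^ N) ^ m) * c =
        (∑ i ∈ Finset.range m, (1 - g ^ N) ^ i) * (g ^ N * c) := by
      rw [← mul_neg_geom_sum]; ring
    rw [this]
    refine (O y).mul_mem hs ?_
    by_cases hyT : y ∈ T
    · exact hN y hyT
    · have : c ∈ O y := by
        by_contra h
        exact hyT ((hT y).mpr ⟨h, hy, hne⟩)
      exact (O y).mul_mem hgy this

/-- If `y` is integral on `S` and vanishes on `S \ T`, then a high power of `y` makes an element
which is integral on `S ∩ T` integral on `S`. -/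
theorem exists_pow_mul_mem {S T : Set ι} (hfin : ∀ a : K, {x | a ∉ O x}.Finite) {y : K}
    (hy : ∀ x ∈ S, y ∈ O x) (hy' : ∀ x ∈ S, x ∉ T → Vanishes (O x) y) (b : K)
    (hb : ∀ x ∈ S, x ∈ T → b ∈ O x) : ∃ N : ℕ, ∀ n ≥ N, ∀ x ∈ S, y ^ n * b ∈ O x := by
  classical
  let B : Finset ι := (hfin b).toFinset.filter (· ∈ S)
  have hB : ∀ x, x ∈ B ↔ b ∉ O x ∧ x ∈ S := fun x => by simp [B]
  have : ∀ x ∈ B, ∃ N : ℕ, ∀ n ≥ N, y ^ n * b ∈ O x := fun x hx =>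
    (hy' x ((hB x).mp hx).2 fun h => ((hB x).mp hx).1 (hb x ((hB x).mp hx).2 h)).exists_forall b
  choose! N hN using this
  refine ⟨B.sup N, fun n hn x hx => ?_⟩
  by_cases hxB : x ∈ B
  · exact hN x hxB n ((Finset.le_sup hxB).trans hn)
  · have : b ∈ O x := by
      by_contra h
      exact hxB ((hB x).mpr ⟨h, hx⟩)
    exact (O x).mul_mem (pow_mem (hy x hx) n) this

/-- Finiteness of the cohomology of a curve covered by two affine charts `S` and `T`: if `y` is
a function on `T` with zeros exactly outside `S`, its inverse is a function on `S` with zeros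
exactly outside `T`, and the functions on `T` are generated as a `k[y]`-module by a finite set `s`,
then the families which are integral almost everywhere are approximable up to a finite-dimensional
space. -/
theorem exists_finiteDimensional {S T : Set ι} (hfin : ∀ a : K, {x | a ∉ O x}.Finite)
    (hST : ∀ x, x ∈ S ∨ x ∈ T) (hS : Approx O S) (hT : Approx O T) {y : K} (hy : y ≠ 0)
    (hyT : ∀ x ∈ T, y ∈ O x) (hyT' : ∀ x ∈ T, x ∉ S → Vanishes (O x) y)
    (hyS : ∀ x ∈ S, y⁻¹ ∈ O x) (hyS' : ∀ x ∈ S, x ∉ T → Vanishes (O x) y⁻¹) (s : Finset K)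
    (hs : ∀ e ∈ s, ∀ x ∈ T, e ∈ O x)
    (hspan : ∀ b : K, (∀ x ∈ T, b ∈ O x) →
      b ∈ Submodule.span k {z | ∃ i : ℕ, ∃ e ∈ s, z = y ^ i * e}) :
    ∃ E : Submodule k (ι → K), FiniteDimensional k E ∧
      almostIntegral O ≤ approximable O Set.univ ⊔ E := by
  classical
  have hN : ∀ e ∈ s, ∃ N : ℕ, ∀ n ≥ N, ∀ x ∈ S, y⁻¹ ^ n * e ∈ O x := fun e he =>
    exists_pow_mul_mem hfin hyS hyS' e fun x _ hx => hs e he x hx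
  choose! N hN using hN
  let M := s.sup N
  let j : K →ₗ[k] (ι → K) := LinearMap.pi fun x => if x ∈ S then 0 else LinearMap.id
  have hj : ∀ b x, x ∈ S → j b x = 0 := fun b x hx => by simp [j, hx]
  have hj' : ∀ b x, x ∉ S → j b x = b := fun b x hx => by simp [j, hx]
  let E : Submodule k K := Submodule.span k
    (((Finset.range M ×ˢ s).image fun p => y⁻¹ ^ p.1 * p.2 : Finset K) : Set K)
  have hE : FiniteDimensional k E := FiniteDimensional.span_finset k _
  refine ⟨E.map j, inferInstance, fun v hv => ?_⟩
  -- Approximating on `S` and then on `T` leaves an element of `K` that is integral on `S ∩ T`.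
  obtain ⟨a, ha⟩ := hS.almostIntegral_le hv
  obtain ⟨b, hb⟩ := @Approx.almostIntegral_le _ _ _ _ _ _ _ _ hT
    (fun x => if x ∈ S then 0 else v x - a) (by
    refine (Set.Finite.union hv (hfin a)).subset fun x hx => ?_
    by_contra h
    simp only [Set.mem_union, not_or] at h
    have h1 : v x ∈ O x := not_not.mp h.1
    have h2 : a ∈ O x := not_not.mp h.2
    refine hx ?_
    change (if x ∈ S then 0 else v x - a) ∈ O x
    split_ifs
    exacts [zero_mem _, (O x).sub_mem h1 h2])
  have hbST : ∀ x ∈ T, x ∈ S → b ∈ O x := fun x hx hx' => by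
    have := hb x hx
    simp only [hx', if_true, zero_sub] at this
    simpa using (O x).neg_mem this
  have h1 : v - j b ∈ approximable O Set.univ := by
    refine ⟨a, fun x _ => ?_⟩
    by_cases hx : x ∈ S
    · simpa [hj b x hx] using ha x hx
    · have := hb x ((hST x).resolve_left hx)
      simp only [hx, if_false] at this
      simpa [hj' b x hx, sub_right_comm] using this
  suffices h2 : j b ∈ approximable O Set.univ ⊔ E.map j by
    have := Submodule.add_mem _ (Submodule.mem_sup_left (T := E.map j) h1) h2
    rwa [sub_add_cancel] at this
  -- Both the elements integral on `S` and those integral on `T` are approximable, so a term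
  -- `y ^ i * e` of `y ^ n * b` only matters if `y⁻¹ ^ n * (y ^ i * e)` is neither, that is, if
  -- `0 < n - i < M`. These finitely many elements span `E`.
  have hjS : ∀ z : K, (∀ x ∈ S, z ∈ O x) → j z ∈ approximable O Set.univ ⊔ E.map j :=
    fun z hz => Submodule.mem_sup_left ⟨z, fun x _ => by
      by_cases hx : x ∈ S
      · simpa [hj z x hx] using hz x hx
      · simp [hj' z x hx]⟩
  have hjT : ∀ z : K, (∀ x ∈ T, z ∈ O x) → j z ∈ approximable O Set.univ ⊔ E.map j :=
    fun z hz => Submodule.mem_sup_left ⟨0, fun x _ => by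
      by_cases hx : x ∈ S
      · simp [hj z x hx]
      · simpa [hj' z x hx] using hz x ((hST x).resolve_left hx)⟩
  obtain ⟨n, hn⟩ := exists_pow_mul_mem hfin hyT hyT' b hbST
  have hspan' := hspan _ (hn n le_rfl)
  have key : ∀ z ∈ Submodule.span k {z | ∃ i : ℕ, ∃ e ∈ s, z = y ^ i * e},
      j (y⁻¹ ^ n * z) ∈ approximable O Set.univ ⊔ E.map j := by
    intro z hz
    induction hz using Submodule.span_induction with
    | mem z hz =>
      obtain ⟨i, e, he, rfl⟩ := hz
      rcases le_total n i with h | h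
      · obtain ⟨m, rfl⟩ := Nat.exists_eq_add_of_le h
        have : y⁻¹ ^ n * (y ^ (n + m) * e) = y ^ m * e := by
          rw [pow_add, ← mul_assoc, ← mul_assoc, ← mul_pow, inv_mul_cancel₀ hy, one_pow, one_mul]
        rw [this]
        exact hjT _ fun x hx => (O x).mul_mem (pow_mem (hyT x hx) m) (hs e he x hx)
      · obtain ⟨m, rfl⟩ := Nat.exists_eq_add_of_le h
        have : y⁻¹ ^ (i + m) * (y ^ i * e) = y⁻¹ ^ m * e := by
          rw [add_comm, pow_add, ← mul_assoc, mul_assoc (y⁻¹ ^ m), ← mul_pow, inv_mul_cancel₀ hy,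
            one_pow, mul_one]
        rw [this]
        rcases le_or_gt M m with hm | hm
        · exact hjS _ (hN e he m ((Finset.le_sup he).trans hm))
        · refine Submodule.mem_sup_right (Submodule.mem_map_of_mem (Submodule.subset_span ?_))
          rw [Finset.mem_coe, Finset.mem_image]
          exact ⟨(m, e), Finset.mem_product.mpr ⟨Finset.mem_range.mpr hm, he⟩, rfl⟩
    | zero => simp
    | add z w _ _ hz hw => rw [mul_add, map_add]; exact Submodule.add_mem _ hz hw
    | smul c z _ hz => rw [mul_smul_comm, map_smul]; exact Submodule.smul_mem _ c hz
  have := key _ hspan'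
  rwa [← mul_assoc, ← mul_pow, inv_mul_cancel₀ hy, one_pow, one_mul] at this

/-- A linear map from the polynomials to a finite-dimensional space has a nonzero kernel. -/
theorem exists_ne_zero_map_eq_zero {V : Type*} [AddCommGroup V] [Module k V] (Q : Submodule k V)
    [FiniteDimensional k Q] (f : k[X] →ₗ[k] V) (hf : ∀ p, f p ∈ Q) : ∃ p ≠ 0, f p = 0 := by
  by_contra! h
  have : Function.Injective (f.codRestrict Q hf) := by
    rw [← LinearMap.ker_eq_bot, LinearMap.ker_eq_bot']
    intro p hp
    by_contra hp0
    exact h p hp0 congr(($hp : V))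
  exact Polynomial.not_finite (R := k) (Module.Finite.of_injective _ this)

theorem finiteDimensional_map_mkQ {L E : Submodule k (ι → K)} [FiniteDimensional k E]
    (h : almostIntegral O ≤ L ⊔ E) :
    FiniteDimensional k ((almostIntegral O).map L.mkQ) := by
  refine Submodule.finiteDimensional_of_le (S₂ := E.map L.mkQ) ?_
  refine (Submodule.map_mono h).trans ?_
  rw [Submodule.map_sup, Submodule.mkQ_map_self, bot_sup_eq]

/-- If `t⁻¹` is integral over a ring that contains `t`, then it belongs to it: an integral equation
of degree `m + 1` is multiplied by `t ^ m`. -/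
theorem inv_mem_of_isIntegral {A : Subalgebra k K} {t : K} (ht : t ∈ A)
    (h : IsIntegral A t⁻¹) : t⁻¹ ∈ A := by
  rcases eq_or_ne t 0 with rfl | ht0
  · simp
  obtain ⟨p, hp, hp'⟩ := h
  rw [← aeval_def, aeval_eq_sum_range, Finset.sum_range_succ, hp.coeff_natDegree, one_smul] at hp'
  rcases Nat.eq_zero_or_eq_succ_pred p.natDegree with h0 | h0
  · simp [h0] at hp'
  · rw [h0] at hp'
    set m := p.natDegree.pred
    have e : t⁻¹ = -(∑ i ∈ Finset.range (m + 1), t ^ m * (p.coeff i • t⁻¹ ^ i)) := by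
      rw [← Finset.mul_sum, eq_neg_of_add_eq_zero_left hp', mul_neg, neg_neg, pow_succ, ← mul_assoc,
        ← mul_pow, mul_inv_cancel₀ ht0, one_pow, one_mul]
    rw [e]
    refine A.neg_mem (sum_mem fun i hi => ?_)
    obtain ⟨j, hj⟩ := Nat.exists_eq_add_of_le (Nat.le_of_lt_succ (Finset.mem_range.mp hi))
    have : t ^ m * (p.coeff i • t⁻¹ ^ i) = p.coeff i * t ^ j := by
      rw [hj, pow_add, Subalgebra.smul_def, smul_eq_mul, inv_pow]
      field_simp
    rw [this]
    exact A.mul_mem (p.coeff i).2 (pow_mem ht j)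

/-- A function with its only pole at the point `P`. Since the space of families modulo approximable
families is finite-dimensional, a polynomial in the inverse of an element `t` which is not
a unit at `P` is the principal part of such a function. -/
theorem exists_transcendental {E : Submodule k (ι → K)} [FiniteDimensional k E]
    (hE : almostIntegral O ≤ approximable O Set.univ ⊔ E) {P : ι} {t : K} (ht : t ∈ O P)
    (ht' : t⁻¹ ∉ O P) : ∃ f : K, (∀ x, x ≠ P → f ∈ O x) ∧ Transcendental k f := by
  classical
  have := finiteDimensional_map_mkQ hE
  obtain ⟨q, hq, hq'⟩ := exists_ne_zero_map_eq_zero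
    ((almostIntegral O).map (approximable O Set.univ).mkQ)
    ((approximable O Set.univ).mkQ ∘ₗ LinearMap.single k (fun _ : ι => K) P ∘ₗ
      (aeval t⁻¹).toLinearMap ∘ₗ LinearMap.mulLeft k (X : k[X])) fun p =>
    Submodule.mem_map_of_mem ((Set.finite_singleton P).subset fun x hx => by
      by_contra h
      refine hx ?_
      simp only [LinearMap.comp_apply, LinearMap.single_apply]
      rw [Pi.single_eq_of_ne h]
      exact zero_mem _)
  simp only [LinearMap.comp_apply, LinearMap.mulLeft_apply, AlgHom.toLinearMap_apply,
    LinearMap.single_apply, Submodule.mkQ_apply, Submodule.Quotient.mk_eq_zero] at hq'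
  obtain ⟨f, hf⟩ := hq'
  refine ⟨f, fun x hx => ?_, fun halg => ht' ?_⟩
  · have := (O x).neg_mem (hf x trivial)
    rwa [Pi.single_eq_of_ne hx, zero_sub, neg_neg] at this
  · -- An algebraic `f` would make `t⁻¹` integral over the ring at `P`.
    have h1 : IsIntegral (O P) f := (isAlgebraic_iff_isIntegral.mp halg).tower_top
    have h2 : aeval t⁻¹ (X * q) - f ∈ O P := by simpa using hf P trivial
    have h3 : IsIntegral (O P) (aeval t⁻¹ (X * q)) := by
      have := h1.add (isIntegral_algebraMap (R := O P) (A := K) (x := ⟨_, h2⟩))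
      have e : f + algebraMap (O P) K ⟨_, h2⟩ = aeval t⁻¹ (X * q) := add_sub_cancel _ _
      rwa [e] at this
    have hne : X * q ≠ 0 := mul_ne_zero X_ne_zero hq
    have hlc : (X * q).leadingCoeff ≠ 0 := leadingCoeff_ne_zero.mpr hne
    have h4 : IsIntegral (O P)
        (aeval t⁻¹ (((X * q) * C (X * q).leadingCoeff⁻¹).map (algebraMap k (O P)))) := by
      rw [aeval_map_algebraMap, map_mul, aeval_C]
      exact h3.mul (isIntegral_algebraMap.tower_top (R := k))
    have hdeg : ((X * q) * C (X * q).leadingCoeff⁻¹).natDegree ≠ 0 := by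
      rw [natDegree_mul_C (inv_ne_zero hlc), natDegree_X_mul hq]
      exact Nat.succ_ne_zero _
    have h5 : IsIntegral (O P) t⁻¹ := IsIntegral.of_aeval_monic
      ((monic_mul_leadingCoeff_inv hne).map _)
      (by rwa [natDegree_map_eq_of_injective (algebraMap k (O P)).injective]) h4
    exact inv_mem_of_isIntegral ht h5

theorem smul_mem_almostIntegral (hfin : ∀ a : K, {x | a ∉ O x}.Finite) (a : K) {v : ι → K}
    (hv : v ∈ almostIntegral O) : a • v ∈ almostIntegral O := by
  refine ((hfin a).union hv).subset fun x hx => ?_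
  by_contra h
  simp only [Set.mem_union, not_or] at h
  exact hx ((O x).mul_mem (not_not.mp h.1) (not_not.mp h.2))

/-- Vanishing of the cohomology of a curve outside of a point `P`: a transcendental function
`f` with its only pole at `P` acts on that finite-dimensional cohomology, so it is killed by
a nonzero polynomial in `f`, but multiplication by such an element is surjective. -/
theorem approx_compl (hfin : ∀ a : K, {x | a ∉ O x}.Finite) {E : Submodule k (ι → K)}
    [FiniteDimensional k E] (hE : almostIntegral O ≤ approximable O Set.univ ⊔ E) {P : ι} {f : K}
    (hf : ∀ x, x ≠ P → f ∈ O x) (hft : Transcendental k f) : Approx O {x | x ≠ P} := by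
  classical
  set L := approximable O {x | x ≠ P} with hL
  have hL_smul : ∀ (p : k[X]) (v : ι → K), v ∈ L → aeval f p • v ∈ L := by
    rintro p v ⟨a, ha⟩
    refine ⟨aeval f p * a, fun x hx => ?_⟩
    have := (O x).mul_mem
      (Algebra.adjoin_le (Set.singleton_subset_iff.mpr (hf x hx))
        (aeval_mem_adjoin_singleton k f (p := p))) (ha x hx)
    rwa [mul_sub] at this
  have := finiteDimensional_map_mkQ (hE.trans (sup_le_sup_right (approximable_anti
    (Set.subset_univ {x | x ≠ P})) E))
  have h1 : ∀ v ∈ almostIntegral O, ∃ p : k[X], p ≠ 0 ∧ aeval f p • v ∈ L := by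
    intro v hv
    obtain ⟨p, hp, hp'⟩ := exists_ne_zero_map_eq_zero ((almostIntegral O).map L.mkQ)
      (L.mkQ ∘ₗ (LinearMap.toSpanSingleton K (ι → K) v).restrictScalars k ∘ₗ
        (aeval f : k[X] →ₐ[k] K).toLinearMap) fun p =>
      Submodule.mem_map_of_mem (smul_mem_almostIntegral hfin (aeval f p) hv)
    exact ⟨p, hp, (Submodule.Quotient.mk_eq_zero L).mp hp'⟩
  have h2 : ∀ G : Finset (ι → K), (∀ v ∈ G, v ∈ almostIntegral O) →
      ∃ p : k[X], p ≠ 0 ∧ ∀ v ∈ G, aeval f p • v ∈ L := by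
    intro G
    induction G using Finset.induction_on with
    | empty => exact fun _ => ⟨1, one_ne_zero, by simp⟩
    | insert v G _ ih =>
      intro hG
      obtain ⟨p, hp, hpG⟩ := ih fun w hw => hG w (Finset.mem_insert_of_mem hw)
      obtain ⟨q, hq, hqv⟩ := h1 v (hG v (Finset.mem_insert_self v G))
      refine ⟨p * q, mul_ne_zero hp hq, fun w hw => ?_⟩
      rcases Finset.mem_insert.mp hw with rfl | hw
      · rw [map_mul, mul_smul]
        exact hL_smul p _ hqv
      · rw [map_mul, mul_comm, mul_smul]
        exact hL_smul q _ (hpG w hw)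
  obtain ⟨G, hG⟩ := Module.Finite.iff_fg.mp this
  choose! g hg hg' using fun w (hw : w ∈ (almostIntegral O).map L.mkQ) => hw
  obtain ⟨p, hp, hpG⟩ := h2 (G.image g) fun v hv => by
    obtain ⟨w, hw, rfl⟩ := Finset.mem_image.mp hv
    exact hg w (hG ▸ Submodule.subset_span hw)
  let L' := L.comap (DistribSMul.toLinearMap k (ι → K) (aeval f p))
  have h3 : almostIntegral O ≤ L' := by
    have hLL' : L ≤ L' := fun v hv => hL_smul p v hv
    have : (almostIntegral O).map L.mkQ ≤ L'.map L.mkQ := by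
      rw [← hG, Submodule.span_le]
      intro w hw
      exact ⟨g w, hpG _ (Finset.mem_image_of_mem g hw), hg' w (hG ▸ Submodule.subset_span hw)⟩
    rw [Submodule.map_le_iff_le_comap, Submodule.comap_map_mkQ, sup_eq_right.mpr hLL'] at this
    exact this
  -- `aeval f p` maps every family into `L`, and every family is a multiple of `aeval f p`.
  have hpf : aeval f p ≠ 0 := fun h => hp (transcendental_iff.mp hft p h)
  refine approx_of_le_approximable fun v hv => ?_
  have := h3 (smul_mem_almostIntegral hfin (aeval f p)⁻¹ hv)
  change aeval f p • (aeval f p)⁻¹ • v ∈ L at this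
  rwa [smul_inv_smul₀ hpf] at this

/-- Strong approximation outside of a point `P` for a family of lattices `M x` in a vector space.
A principal part `c` at `x` is that of `(α * h) • c`. Here `h ≠ 0` is integral outside of `P` and
vanishes to high order at `x` and at the poles of `c`, and `α` has the principal part of `h⁻¹` at
`x` and is integral at the remaining points. Such an `h` is a product of polynomials in `f`, since
the residue of `f` at every point is algebraic over `k`. -/
theorem exists_approx_module {P : ι} (happ : Approx O {x | x ≠ P}) {f : K}
    (hf : ∀ x, x ≠ P → f ∈ O x) (hft : Transcendental k f)
    (hnull : ∀ x, ∀ a ∈ O x, ∃ q : k[X], q ≠ 0 ∧ Vanishes (O x) (aeval a q))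
    {N : Type*} [AddCommGroup N] [Module K N] (M : ι → AddSubgroup N)
    (hsmul : ∀ x, ∀ r ∈ O x, ∀ m ∈ M x, r • m ∈ M x) (hM : ∀ c : N, {x | c ∉ M x}.Finite)
    (hfrac : ∀ x, ∀ c : N, ∃ s : K, s ≠ 0 ∧ s • c ∈ M x) (v : ι → N)
    (hv : {x | v x ∉ M x}.Finite) : ∃ a : N, ∀ x, x ≠ P → v x - a ∈ M x := by
  classical
  have haeval : ∀ q : k[X], ∀ x, x ≠ P → aeval f q ∈ O x := fun q x hx =>
    Algebra.adjoin_le (Set.singleton_subset_iff.mpr (hf x hx)) (aeval_mem_adjoin_singleton k f)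
  -- A function which is integral outside of `P` and whose multiples move `c` into `M y`.
  have h1 : ∀ c : N, ∀ y, y ≠ P → ∃ h : K, h ≠ 0 ∧ (∀ x, x ≠ P → h ∈ O x) ∧
      ∀ r ∈ O y, (r * h) • c ∈ M y := by
    intro c y hy
    obtain ⟨s, hs, hsc⟩ := hfrac y c
    obtain ⟨q, hq, hvan⟩ := hnull y f (hf y hy)
    obtain ⟨n, hn⟩ := hvan.2 s⁻¹
    refine ⟨aeval f q ^ n, pow_ne_zero n fun h => hq (transcendental_iff.mp hft q h),
      fun x hx => pow_mem (haeval q x hx) n, fun r hr => ?_⟩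
    have : (r * aeval f q ^ n) • c = (r * (aeval f q ^ n * s⁻¹)) • s • c := by
      rw [smul_smul]
      congr 1
      field_simp
    rw [this]
    exact hsmul y _ ((O y).mul_mem hr hn) _ hsc
  have h2 : ∀ c : N, ∀ T : Finset ι, P ∉ T → ∃ h : K, h ≠ 0 ∧ (∀ x, x ≠ P → h ∈ O x) ∧
      ∀ y ∈ T, ∀ r ∈ O y, (r * h) • c ∈ M y := by
    intro c T hT
    have hT' : ∀ y ∈ T, y ≠ P := fun y hy e => hT (e ▸ hy)
    choose! h h0 hO hc using h1 c
    refine ⟨∏ y ∈ T, h y, Finset.prod_ne_zero_iff.mpr fun y hy => h0 y (hT' y hy),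
      fun x hx => prod_mem fun y hy => hO y (hT' y hy) x hx, fun y hy r hr => ?_⟩
    rw [← Finset.mul_prod_erase T h hy, mul_comm (h y), ← mul_assoc]
    exact hc y (hT' y hy) _ ((O y).mul_mem hr (prod_mem fun z hz =>
      hO z (hT' z (Finset.mem_of_mem_erase hz)) y (hT' y hy)))
  have h3 : ∀ x, x ≠ P → ∀ c : N, ∃ a : N, a - c ∈ M x ∧ ∀ y, y ≠ P → y ≠ x → a ∈ M y := by
    intro x hx c
    let T : Finset ι := insert x ((hM c).toFinset.erase P)
    obtain ⟨h, h0, hO, hc⟩ := h2 c T (by simp [T, hx.symm])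
    obtain ⟨α, hα, hα'⟩ := happ x hx h⁻¹
    refine ⟨(α * h) • c, ?_, fun y hy hyx => ?_⟩
    · have : (α * h) • c - c = ((α - h⁻¹) * h) • c := by
        rw [sub_mul, inv_mul_cancel₀ h0, sub_smul, one_smul]
      exact this ▸ hc x (Finset.mem_insert_self _ _) _ hα
    · by_cases hyT : y ∈ T
      · exact hc y hyT α (hα' y hy hyx)
      · have : c ∈ M y := by
          by_contra hcy
          exact hyT (by simp [T, hy, hcy])
        exact hsmul y _ ((O y).mul_mem (hα' y hy hyx) (hO y hy)) _ this
  choose! a ha ha' using h3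
  let T : Finset ι := hv.toFinset.erase P
  have hT : ∀ x, x ∈ T ↔ x ≠ P ∧ v x ∉ M x := fun x => by simp [T]
  refine ⟨∑ x ∈ T, a x (v x), fun x hx => ?_⟩
  by_cases hxT : x ∈ T
  · rw [← Finset.add_sum_erase T _ hxT, ← sub_sub]
    refine (M x).sub_mem ?_ (sum_mem fun y hy => ?_)
    · simpa using (M x).neg_mem (ha x hx (v x))
    · exact ha' y ((hT y).mp (Finset.mem_of_mem_erase hy)).1 _ x hx
        (Finset.ne_of_mem_erase hy).symm
  · have hvx : v x ∈ M x := by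
      by_contra hvx
      exact hxT ((hT x).mpr ⟨hx, hvx⟩)
    exact (M x).sub_mem hvx (sum_mem fun y hy =>
      ha' y ((hT y).mp hy).1 _ x hx fun e => hxT (e ▸ hy))

end Approximation

/-! ### Completion of a one-dimensional local domain -/

section OneDimensional

variable {O : Type u} [CommRing O] [IsLocalRing O] [IsNoetherianRing O]

theorem exists_pow_maximalIdeal_le [Ring.DimensionLEOne O] [IsDomain O] {t : O} (ht : t ≠ 0) :
    ∃ n : ℕ, maximalIdeal O ^ n ≤ Ideal.span {t} := by
  refine Ideal.exists_pow_le_of_le_radical_of_fg ?_ (IsNoetherian.noetherian _)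
  rw [Ideal.radical_eq_sInf]
  refine le_sInf fun p ⟨hp, hp'⟩ => ?_
  have hp0 : p ≠ ⊥ := by
    rintro rfl
    exact ht (by simpa using hp)
  exact (eq_maximalIdeal (Ring.DimensionLEOne.maximalOfPrime hp0 hp')).ge

/-- The image of `M` is dense in its completion, also for the topology given by `t`. -/
theorem exists_eq_of_add_smul {M : Type u} [AddCommGroup M] [Module O M] {n : ℕ} {t : O}
    (ht : maximalIdeal O ^ n ≤ Ideal.span {t}) (z : Hat O M) :
    ∃ (m : M) (y : Hat O M), z = AdicCompletion.of (maximalIdeal O) M m + t • y := by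
  obtain ⟨m, hm⟩ := Submodule.mkQ_surjective _ (AdicCompletion.eval (maximalIdeal O) M n z)
  have h1 : z - AdicCompletion.of (maximalIdeal O) M m ∈
      (AdicCompletion.eval (maximalIdeal O) M n).ker := by
    rw [LinearMap.mem_ker, map_sub, AdicCompletion.eval_of, hm, sub_self]
  rw [← AdicCompletion.pow_smul_top_eq_ker_eval (IsNoetherian.noetherian _)] at h1
  have h2 := Submodule.smul_mono_left ht h1
  rw [Submodule.ideal_span_singleton_smul, Submodule.mem_smul_pointwise_iff_exists] at h2
  obtain ⟨y, -, hy⟩ := h2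
  exact ⟨m, y, by rw [hy, add_sub_cancel]⟩

theorem exists_eq_algebraMap_add_mul {n : ℕ} {t : O} (ht : maximalIdeal O ^ n ≤ Ideal.span {t})
    (z : Hat O O) : ∃ (a : O) (y : Hat O O),
      z = algebraMap O (Hat O O) a + algebraMap O (Hat O O) t * y := by
  obtain ⟨m, y, rfl⟩ := exists_eq_of_add_smul ht z
  exact ⟨m, y, by rw [Algebra.smul_def]; rfl⟩

theorem pow_maximalIdeal_hat_le {n : ℕ} {t : O} (ht : maximalIdeal O ^ n ≤ Ideal.span {t}) :
    maximalIdeal (Hat O O) ^ n ≤ Ideal.span {algebraMap O (Hat O O) t} := by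
  rw [AdicCompletion.maximalIdeal_eq_map, ← Ideal.map_pow, ← Set.image_singleton, ← Ideal.map_span]
  exact Ideal.map_mono ht

theorem isNoetherianRing_quotient_span {n : ℕ} {t : O}
    (ht : maximalIdeal O ^ n ≤ Ideal.span {t}) :
    IsNoetherianRing (Hat O O ⧸ Ideal.span {algebraMap O (Hat O O) t}) := by
  refine isNoetherianRing_of_surjective O _
    ((Ideal.Quotient.mk _).comp (algebraMap O (Hat O O))) fun z => ?_
  obtain ⟨z, rfl⟩ := Ideal.Quotient.mk_surjective z
  obtain ⟨a, y, rfl⟩ := exists_eq_algebraMap_add_mul ht z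
  refine ⟨a, ?_⟩
  rw [RingHom.comp_apply, Ideal.Quotient.eq, sub_add_cancel_left]
  exact neg_mem (Ideal.mul_mem_right _ _ (Ideal.mem_span_singleton_self _))

/-- The topologies given by `t` and by the maximal ideal agree on the completion. -/
theorem isAdicComplete_span {n : ℕ} {t : O} (ht : maximalIdeal O ^ n ≤ Ideal.span {t})
    (htm : t ∈ maximalIdeal O) :
    IsAdicComplete (Ideal.span {algebraMap O (Hat O O) t}) (Hat O O) := by
  set I := Ideal.span {algebraMap O (Hat O O) t}
  have hI : I ≤ maximalIdeal (Hat O O) := by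
    rw [Ideal.span_singleton_le_iff_mem, AdicCompletion.maximalIdeal_eq_map]
    exact Ideal.mem_map_of_mem _ htm
  have hI' : ∀ j : ℕ, maximalIdeal (Hat O O) ^ (n * j) ≤ I ^ j := fun j => by
    rw [pow_mul]
    exact Ideal.pow_right_mono (pow_maximalIdeal_hat_le ht) j
  have hc : IsAdicComplete (maximalIdeal (Hat O O)) (Hat O O) := inferInstance
  refine { haus' := fun x hx => ?_, prec' := fun f hf => ?_ }
  · refine hc.haus' x fun j => ?_
    have := hx j
    rw [SModEq.zero] at this ⊢
    exact Submodule.smul_mono_left (Ideal.pow_right_mono hI j) this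
  · obtain ⟨L, hL⟩ := hc.prec' f fun {i j} hij => by
      have := hf hij
      rw [SModEq.sub_mem] at this ⊢
      exact Submodule.smul_mono_left (Ideal.pow_right_mono hI i) this
    refine ⟨L, fun j => ?_⟩
    have h1 := hf (le_max_left j (n * j))
    have h2 : f (max j (n * j)) ≡ L [SMOD I ^ j • (⊤ : Submodule (Hat O O) (Hat O O))] := by
      have := hL (max j (n * j))
      rw [SModEq.sub_mem] at this ⊢
      refine Submodule.smul_mono_left ?_ this
      exact (Ideal.pow_le_pow_right (le_max_right _ _)).trans (hI' j)
    exact h1.trans h2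

theorem isPrecomplete_pi {R M ι : Type*} [CommRing R] [AddCommGroup M] [Module R M] [Finite ι]
    (I : Ideal R) [IsPrecomplete I M] : IsPrecomplete I (ι → M) := by
  classical
  have := Fintype.ofFinite ι
  refine ⟨fun f hf => ?_⟩
  have hproj : ∀ (i : ι) (n : ℕ) (x y : ι → M), x ≡ y [SMOD I ^ n • (⊤ : Submodule R (ι → M))] →
      x i ≡ y i [SMOD I ^ n • (⊤ : Submodule R M)] := fun i n x y h => by
    rw [SModEq.sub_mem] at h ⊢
    have := Submodule.mem_map_of_mem (f := LinearMap.proj i) h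
    rw [Submodule.map_smul''] at this
    exact Submodule.smul_mono le_rfl le_top this
  choose L hL using fun i => IsPrecomplete.prec' (I := I) (fun n => f n i)
    fun {m n} h => hproj i m _ _ (hf h)
  refine ⟨L, fun n => ?_⟩
  rw [SModEq.sub_mem, ← Finset.univ_sum_single (f n - L)]
  refine sum_mem fun i _ => ?_
  have := Submodule.mem_map_of_mem (f := LinearMap.single R (fun _ : ι => M) i)
    (SModEq.sub_mem.mp (hL i n))
  rw [Submodule.map_smul''] at this
  exact Submodule.smul_mono le_rfl le_top this

/-- A ring which is complete for the topology of a principal ideal is Noetherian if its quotient is: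
a prime that does not contain the generator `τ` is generated by lifts of generators modulo `τ`, by
completeness. -/
theorem isNoetherianRing_of_isAdicComplete {A : Type*} [CommRing A] (τ : A)
    [IsNoetherianRing (A ⧸ Ideal.span {τ})] [IsAdicComplete (Ideal.span {τ}) A] :
    IsNoetherianRing A := by
  classical
  refine IsNoetherianRing.of_prime fun p hp => ?_
  obtain ⟨G, hG⟩ : (p.map (Ideal.Quotient.mk (Ideal.span {τ}))).FG := IsNoetherian.noetherian _
  have hlift : ∀ g ∈ G, ∃ a ∈ p, Ideal.Quotient.mk (Ideal.span {τ}) a = g := fun g hg =>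
    (Ideal.mem_map_iff_of_surjective _ Ideal.Quotient.mk_surjective).mp (hG ▸ Ideal.subset_span hg)
  choose! a ha ha' using hlift
  let q : Ideal A := Ideal.span (G.image a)
  have hq : q.FG := ⟨_, rfl⟩
  have hqp : q ≤ p := by
    rw [Ideal.span_le]
    intro z hz
    obtain ⟨g, hg, rfl⟩ := Finset.mem_image.mp (Finset.mem_coe.mp hz)
    exact ha g hg
  have hpq : ∀ z ∈ p, ∃ w ∈ q, ∃ y, z = w + τ * y := by
    intro z hz
    have h1 : q.map (Ideal.Quotient.mk (Ideal.span {τ})) =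
        p.map (Ideal.Quotient.mk (Ideal.span {τ})) := by
      rw [Ideal.map_span, ← hG]
      congr 1
      ext g
      simp only [Set.mem_image, Finset.mem_coe, Finset.mem_image]
      constructor
      · rintro ⟨_, ⟨g, hg, rfl⟩, rfl⟩
        rwa [ha' g hg]
      · exact fun hg => ⟨_, ⟨g, hg, rfl⟩, ha' g hg⟩
    obtain ⟨w, hw, hwz⟩ := (Ideal.mem_map_iff_of_surjective _ Ideal.Quotient.mk_surjective).mp
      (h1 ▸ Ideal.mem_map_of_mem _ hz)
    obtain ⟨y, hy⟩ := Ideal.mem_span_singleton.mp (Ideal.Quotient.eq.mp hwz.symm)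
    exact ⟨w, hw, y, by rw [← hy, add_sub_cancel]⟩
  by_cases hτ : τ ∈ p
  · have : p = q ⊔ Ideal.span {τ} := by
      refine le_antisymm (fun z hz => ?_)
        (sup_le hqp ((Ideal.span_singleton_le_iff_mem _).mpr hτ))
      obtain ⟨w, hw, y, rfl⟩ := hpq z hz
      exact Ideal.add_mem _ (Ideal.mem_sup_left hw)
        (Ideal.mem_sup_right (Ideal.mul_mem_right _ _ (Ideal.mem_span_singleton_self τ)))
    rw [this]
    exact Submodule.FG.sup hq ⟨{τ}, by simp⟩
  · let φ : (G → A) →ₗ[A] p := Fintype.linearCombination A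
      fun g : G => (⟨a g, ha g g.2⟩ : p)
    have hφ : ∀ w (hw : w ∈ q), ∃ c, (φ c : A) = w := by
      intro w hw
      have : q ≤ (LinearMap.range φ).map p.subtype := by
        rw [Ideal.span_le]
        intro z hz
        obtain ⟨g, hg, rfl⟩ := Finset.mem_image.mp (Finset.mem_coe.mp hz)
        exact ⟨_, ⟨Pi.single ⟨g, hg⟩ 1, rfl⟩, by simp [φ]⟩
      obtain ⟨_, ⟨c, rfl⟩, hc⟩ := this hw
      exact ⟨c, hc⟩
    have : IsHausdorff (Ideal.span {τ}) p := ⟨fun x hx => by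
      refine Subtype.ext (IsHausdorff.haus' (I := Ideal.span {τ}) (x : A) fun j => ?_)
      have := hx j
      rw [SModEq.zero] at this ⊢
      have := Submodule.mem_map_of_mem (f := p.subtype) this
      rw [Submodule.map_smul''] at this
      exact Submodule.smul_mono le_rfl le_top this⟩
    have hsurj : Function.Surjective φ := by
      have := isPrecomplete_pi (ι := G) (M := A) (Ideal.span {τ})
      refine surjective_of_mkQ_comp_surjective (I := Ideal.span {τ}) fun z => ?_
      obtain ⟨z, rfl⟩ := Submodule.mkQ_surjective _ z
      obtain ⟨w, hw, y, hy⟩ := hpq z z.2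
      obtain ⟨c, hc⟩ := hφ w hw
      have hyp : y ∈ p := by
        refine (hp.mem_or_mem (x := τ) ?_).resolve_left hτ
        rw [← add_sub_cancel_left w (τ * y), ← hy]
        exact p.sub_mem z.2 (hqp hw)
      refine ⟨c, ?_⟩
      rw [LinearMap.comp_apply, ← sub_eq_zero, ← map_sub, Submodule.mkQ_apply,
        Submodule.Quotient.mk_eq_zero, Submodule.ideal_span_singleton_smul]
      refine Submodule.mem_smul_pointwise_iff_exists _ _ _ |>.mpr ⟨-⟨y, hyp⟩, trivial, ?_⟩
      refine Subtype.ext ?_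
      simp [hc, hy]
    exact Module.Finite.iff_fg.mp (Module.Finite.of_surjective φ hsurj)

theorem isNoetherianRing_hat {n : ℕ} {t : O} (ht : maximalIdeal O ^ n ≤ Ideal.span {t})
    (htm : t ∈ maximalIdeal O) : IsNoetherianRing (Hat O O) :=
  have := isNoetherianRing_quotient_span ht
  have := isAdicComplete_span ht htm
  isNoetherianRing_of_isAdicComplete (algebraMap O (Hat O O) t)

/-- Every nonzerodivisor of the completion divides a power of the parameter `t`, since the maximal
ideal is the only prime that contains it: by Krull's Hauptidealsatz the other primes are minimal. -/
theorem exists_mul_eq_pow {n : ℕ} {t : O} (ht : maximalIdeal O ^ n ≤ Ideal.span {t})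
    (htm : t ∈ maximalIdeal O) {s : Hat O O} (hs : s ∈ (Hat O O)⁰) :
    ∃ (j : ℕ) (c : Hat O O), c * s = algebraMap O (Hat O O) t ^ j := by
  set τ := algebraMap O (Hat O O) t
  have := isNoetherianRing_hat ht htm
  suffices h : τ ∈ (Ideal.span {s}).radical by
    obtain ⟨j, hj⟩ := h
    obtain ⟨c, hc⟩ := Ideal.mem_span_singleton'.mp hj
    exact ⟨j, c, hc⟩
  rw [← Ideal.sInf_minimalPrimes]
  refine Submodule.mem_sInf.mpr fun p hp => ?_
  by_contra hτ
  have hpp : Ideal.IsPrime p := hp.1.1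
  have hsp : s ∈ p := hp.1.2 (Ideal.mem_span_singleton_self s)
  have hm : maximalIdeal (Hat O O) ∈ (Ideal.span {τ}).minimalPrimes := by
    refine ⟨⟨inferInstance, ?_⟩, fun q ⟨hq, hq'⟩ _ => ?_⟩
    · rw [Ideal.span_singleton_le_iff_mem, AdicCompletion.maximalIdeal_eq_map]
      exact Ideal.mem_map_of_mem _ htm
    · exact Ideal.IsPrime.le_of_pow_le ((pow_maximalIdeal_hat_le ht).trans hq')
  have h1 := Ideal.height_le_one_of_isPrincipal_of_mem_minimalPrimes _ _ hm
  have hlt : p < maximalIdeal (Hat O O) := by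
    refine lt_of_le_of_ne (le_maximalIdeal hpp.ne_top) ?_
    rintro rfl
    exact hτ (hm.1.2 (Ideal.mem_span_singleton_self τ))
  have h2 : p ∈ minimalPrimes (Hat O O) := by
    rw [← Ideal.height_eq_zero_iff]
    have h3 := Ideal.height_add_one_le_of_lt_of_isPrime hlt
    exact nonpos_iff_eq_zero.mp (ENat.add_le_add_iff_right ENat.one_ne_top |>.mp
      (by simpa using h3.trans h1))
  exact (Set.disjoint_left.mp (Ideal.disjoint_nonZeroDivisors_of_mem_minimalPrimes h2)) hsp hs

end OneDimensional

/-! ### Completion of a torsion-free module -/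

section TorsionFree

variable {O : Type u} [CommRing O] [IsLocalRing O] [IsNoetherianRing O]
  {M : Type u} [AddCommGroup M] [Module O M]

theorem smul_hatTensor_injective (s : O⁰) :
    Function.Injective fun w : HatTensor O M => (s : O) • w := by
  have := (isUnit_hatFrac O s).map
    (algebraMap (HatFrac O) (Module.End (HatFrac O) (HatTensor O M)))
  rw [Module.End.isUnit_iff] at this
  convert this.1 using 1
  ext w
  simp

variable [IsDomain O]

theorem smul_hat_injective [Module.Finite O M] [Module.IsTorsionFree O M] {r : O} (hr : r ≠ 0) :
    Function.Injective fun z : Hat O M => r • z := by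
  have h := AdicCompletion.map_injective (maximalIdeal O) (f := LinearMap.lsmul O M r)
    (smul_right_injective M hr)
  intro z w hzw
  refine h ?_
  have (z : Hat O M) : AdicCompletion.map (maximalIdeal O) (LinearMap.lsmul O M r) z = r • z := by
    induction z using AdicCompletion.induction_on with
    | _ z => rfl
  rw [this, this]
  exact hzw

variable [Ring.DimensionLEOne O]

/-- For a torsion-free module over a one-dimensional local domain, no information is lost in passing
from the completion to its localization, because every nonzerodivisor divides an element of `O`. -/
theorem ofHat_injective [Module.Finite O M] [Module.IsTorsionFree O M] (hO : ¬ IsField O) :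
    Function.Injective (ofHat O M) := by
  obtain ⟨t, htm, ht0⟩ := Submodule.exists_mem_ne_zero_of_ne_bot
    (mt IsLocalRing.isField_iff_maximalIdeal_eq.mpr hO)
  obtain ⟨n, hn⟩ := exists_pow_maximalIdeal_le ht0
  rw [injective_iff_map_eq_zero]
  intro z hz
  obtain ⟨s, hs⟩ := (IsLocalizedModule.eq_zero_iff (Hat O O)⁰
    (TensorProduct.mk (Hat O O) (HatFrac O) (Hat O M) 1)).mp hz
  obtain ⟨j, c, hc⟩ := exists_mul_eq_pow hn htm s.2
  refine smul_hat_injective (M := M) (pow_ne_zero j ht0) ?_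
  have : t ^ j • z = c • s • z := by
    rw [Submonoid.smul_def, smul_smul, hc, ← map_pow, algebraMap_smul]
  simp only [this, hs, smul_zero]

open scoped Pointwise in
/-- `M` is the intersection of its localization with its completion. -/
theorem exists_eq_of_liftGeneric_eq [Module.Finite O M] [Module.IsTorsionFree O M]
    (hO : ¬ IsField O) {N : Type u} [AddCommGroup N] [Module O N] (l : M →ₗ[O] N)
    (hl : IsLocalizedModule O⁰ l) {a : N} {b : Hat O M} (h : liftGeneric l hl a = ofHat O M b) :
    ∃ m, l m = a := by
  obtain ⟨⟨m, s⟩, hm⟩ := IsLocalizedModule.surj O⁰ l a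
  have h1 : AdicCompletion.of (maximalIdeal O) M m = (s : O) • b := by
    refine ofHat_injective hO ?_
    rw [← liftGeneric_apply l hl, ← hm, Submonoid.smul_def, map_smul, h]
    exact ((ofHat O M).restrictScalars O).map_smul (s : O) b |>.symm
  -- `m` is divisible by `s` in the completion, hence modulo every power of the maximal ideal, and
  -- by Krull's intersection theorem for `M / s M` it is divisible by `s` in `M`.
  have h2 : m ∈ (s : O) • (⊤ : Submodule O M) := by
    rw [← Submodule.Quotient.mk_eq_zero]
    refine IsHausdorff.haus' (I := maximalIdeal O) _ fun n => ?_
    rw [SModEq.zero]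
    obtain ⟨m', hm'⟩ := Submodule.mkQ_surjective _ (AdicCompletion.eval (maximalIdeal O) M n b)
    have h3 := congr(AdicCompletion.eval (maximalIdeal O) M n $h1)
    rw [AdicCompletion.eval_of, map_smul, ← hm', ← map_smul, ← sub_eq_zero, ← map_sub,
      Submodule.mkQ_apply, Submodule.Quotient.mk_eq_zero] at h3
    have h4 := Submodule.mem_map_of_mem (f := ((s : O) • (⊤ : Submodule O M)).mkQ) h3
    rw [Submodule.map_smul''] at h4
    have h5 : ((s : O) • (⊤ : Submodule O M)).mkQ (m - (s : O) • m') =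
        Submodule.Quotient.mk m := by
      rw [map_sub, Submodule.mkQ_apply, sub_eq_self, Submodule.mkQ_apply,
        Submodule.Quotient.mk_eq_zero]
      exact Submodule.smul_mem_pointwise_smul _ _ _ trivial
    rw [← h5]
    exact Submodule.smul_mono le_rfl le_top h4
  obtain ⟨m', -, rfl⟩ := h2
  refine ⟨m', ?_⟩
  refine IsLocalizedModule.smul_injective l s ?_
  change s • l m' = s • a
  rw [hm]
  exact (l.map_smul (s : O) m').symm

/-- The localization is dense: modulo the completion of `M`, every element is in the image of a
localization of `M`. -/
theorem exists_eq_liftGeneric_add (hO : ¬ IsField O) {N : Type u} [AddCommGroup N] [Module O N]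
    (l : M →ₗ[O] N) (hl : IsLocalizedModule O⁰ l) (v : HatTensor O M) :
    ∃ (a : N) (b : Hat O M), v = liftGeneric l hl a + ofHat O M b := by
  obtain ⟨t, htm, ht0⟩ := Submodule.exists_mem_ne_zero_of_ne_bot
    (mt IsLocalRing.isField_iff_maximalIdeal_eq.mpr hO)
  obtain ⟨n, hn⟩ := exists_pow_maximalIdeal_le ht0
  obtain ⟨⟨z, s⟩, hz⟩ := IsLocalizedModule.surj (Hat O O)⁰
    (TensorProduct.mk (Hat O O) (HatFrac O) (Hat O M) 1) v
  obtain ⟨j, c, hc⟩ := exists_mul_eq_pow hn htm s.2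
  have hv : (t ^ j) • v = ofHat O M (c • z) := by
    have : ofHat O M (c • z) = c • (s : Hat O O) • v := by
      rw [map_smul]
      exact congrArg (c • ·) hz.symm
    rw [this, smul_smul, hc, ← map_pow, algebraMap_smul]
  obtain ⟨n', hn'⟩ := exists_pow_maximalIdeal_le (pow_ne_zero j ht0)
  obtain ⟨m, y, hy⟩ := exists_eq_of_add_smul hn' (c • z)
  have htj : t ^ j ∈ O⁰ := mem_nonZeroDivisors_of_ne_zero (pow_ne_zero j ht0)
  have hu := (IsLocalizedModule.map_units l ⟨t ^ j, htj⟩)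
  rw [Module.End.isUnit_iff] at hu
  obtain ⟨a, ha⟩ := hu.2 (l m)
  have ha : t ^ j • a = l m := ha
  refine ⟨a, y, ?_⟩
  refine smul_hatTensor_injective ⟨t ^ j, htj⟩ ?_
  change t ^ j • v = t ^ j • (liftGeneric l hl a + ofHat O M y)
  rw [hv, hy, smul_add, ← map_smul, ha, liftGeneric_apply, map_add]
  congr 1
  exact ((ofHat O M).restrictScalars O).map_smul (t ^ j) y

end TorsionFree

/-! ### The local rings of a projective curve -/

namespace ProjectiveCurve

section LocalRings

variable {k : Type u} [Field k] (C : ProjectiveCurve k)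

theorem isClosed_of_ne_η {x : C.scheme} (hx : x ≠ C.η) : IsClosed ({x} : Set C.scheme) := by
  obtain ⟨y, hy, hyc⟩ := (isClosed_closure (s := ({x} : Set C.scheme))).exists_closed_singleton
    (Set.singleton_nonempty x).closure
  have := C.eq_of_mem_irreducible (closure {x}) isIrreducible_singleton.closure isClosed_closure
    (fun h => hx ((isGenericPoint_def.mpr h).eq (genericPoint_spec C.scheme))) ⟨y, hyc⟩ hy
  have hxy : x = y := by
    have : x ∈ ({y} : Set C.scheme) := this ▸ subset_closure rfl
    exact this
  exact hxy ▸ hyc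

theorem ne_η (x : C.ClosedPoint) : x.1 ≠ C.η := fun h => C.not_isClosed_η (h ▸ x.2)

/-- The spectrum of the local ring at `x` consists of the points of the curve that specialize to
`x`, and the only such points are the generic point and `x`. -/
instance (x : C.scheme) : Ring.DimensionLEOne (C.scheme.presheaf.stalk x) where
  maximalOfPrime {p} hp0 hp := by
    let q : Spec (C.scheme.presheaf.stalk x) := ⟨p, hp⟩
    let f := C.scheme.fromSpecStalk x
    have hinj : Function.Injective f := f.isEmbedding.injective
    have hq : f q ⤳ x := by
      have : f q ∈ Set.range f := ⟨q, rfl⟩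
      rwa [Scheme.range_fromSpecStalk] at this
    by_cases hη : f q = C.η
    · have h0 : (⟨⊥, Ideal.isPrime_bot⟩ : PrimeSpectrum (C.scheme.presheaf.stalk x)) ⤳ q :=
        (PrimeSpectrum.le_iff_specializes _ _).mp bot_le
      have h1 := h0.map f.continuous
      have h2 : f (⟨⊥, Ideal.isPrime_bot⟩ : PrimeSpectrum (C.scheme.presheaf.stalk x)) = f q :=
        (h1.antisymm (hη ▸ genericPoint_specializes _)).eq
      exact absurd (congrArg PrimeSpectrum.asIdeal (hinj h2)).symm hp0
    · have h1 : x = f q := hq.mem_closed (C.isClosed_of_ne_η hη) rfl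
      have h2 : q = closedPoint (C.scheme.presheaf.stalk x) := hinj (by
        rw [← h1]
        exact Scheme.fromSpecStalk_closedPoint.symm)
      have : p = maximalIdeal _ := congrArg PrimeSpectrum.asIdeal h2
      rw [this]
      infer_instance

theorem not_isField_stalk (x : C.ClosedPoint) : ¬ IsField (C.scheme.presheaf.stalk x.1) := by
  intro h
  let := h.toField
  obtain ⟨p, hp⟩ := (Scheme.range_fromSpecStalk (X := C.scheme) (x := x.1)).ge
    (genericPoint_specializes x.1)
  obtain ⟨q, hq⟩ := (Scheme.range_fromSpecStalk (X := C.scheme) (x := x.1)).ge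
    (specializes_refl x.1)
  have : Subsingleton (Spec (C.scheme.presheaf.stalk x.1)) :=
    inferInstanceAs (Subsingleton (PrimeSpectrum (C.scheme.presheaf.stalk x.1)))
  exact C.ne_η x (hq.symm.trans (Subsingleton.elim q p ▸ hp))

/-- The field of rational functions. -/
abbrev K : Type u := C.scheme.functionField

instance : Field C.K := inferInstanceAs (Field C.scheme.functionField)

/-- The inclusion of the local ring at `x` into the function field. -/
def toK (x : C.scheme) : C.scheme.presheaf.stalk x →ₐ[k] C.K :=
  { (C.scheme.presheaf.stalkSpecializes (genericPoint_specializes x)).hom with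
    commutes' := C.specializes_algebraMap (genericPoint_specializes x) }

theorem toK_injective (x : C.scheme) : Function.Injective (C.toK x) :=
  IsFractionRing.injective (C.scheme.presheaf.stalk x) C.scheme.functionField

/-- The local ring at `x`, as a subring of the function field. -/
def localRing (x : C.scheme) : Subalgebra k C.K := (C.toK x).range

theorem toK_mem (x : C.scheme) (a : C.scheme.presheaf.stalk x) : C.toK x a ∈ C.localRing x :=
  ⟨a, rfl⟩

theorem exists_div (x : C.scheme) (c : C.K) :
    ∃ a s : C.scheme.presheaf.stalk x, s ≠ 0 ∧ C.toK x s * c = C.toK x a := by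
  obtain ⟨⟨a, s⟩, h⟩ := IsLocalization.surj (C.scheme.presheaf.stalk x)⁰
    (c : C.scheme.functionField)
  exact ⟨a, s, nonZeroDivisors.ne_zero s.2, (mul_comm _ _).trans h⟩

/-- The elements of the maximal ideal at `x` are topologically nilpotent: a power of such an element
is a multiple of any given denominator. -/
theorem vanishes_toK {x : C.scheme} {t : C.scheme.presheaf.stalk x} (ht : t ∈ maximalIdeal _) :
    Vanishes (C.localRing x) (C.toK x t) := by
  refine ⟨C.toK_mem x t, fun c => ?_⟩
  obtain ⟨a, s, hs, hc⟩ := C.exists_div x c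
  obtain ⟨n, hn⟩ := exists_pow_maximalIdeal_le hs
  obtain ⟨w, hw⟩ := Ideal.mem_span_singleton.mp (hn (Ideal.pow_mem_pow ht n))
  refine ⟨n, w * a, ?_⟩
  change C.toK x (w * a) = C.toK x t ^ n * c
  rw [← map_pow, hw, map_mul, map_mul, ← hc]
  ring

/-- A section of the structure sheaf as a rational function. -/
def sectionToK (U : C.scheme.Opens) (hU : C.η ∈ U) : Γ(C.scheme, U) →ₐ[k] C.K :=
  { (C.scheme.presheaf.germ U C.η hU).hom with
    commutes' := fun c => (C.algebraMap_stalk U C.η hU c).symm }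

theorem toK_germ (U : C.scheme.Opens) (hU : C.η ∈ U) {x : C.scheme} (hx : x ∈ U)
    (s : Γ(C.scheme, U)) : C.toK x (C.scheme.presheaf.germ U x hx s) = C.sectionToK U hU s :=
  TopCat.Presheaf.germ_stalkSpecializes_apply C.scheme.presheaf _ _ _

theorem sectionToK_mem (U : C.scheme.Opens) (hU : C.η ∈ U) {x : C.scheme} (hx : x ∈ U)
    (s : Γ(C.scheme, U)) : C.sectionToK U hU s ∈ C.localRing x :=
  C.toK_germ U hU hx s ▸ C.toK_mem x _

theorem finite_notMem_localRing (c : C.K) : {x : C.ClosedPoint | c ∉ C.localRing x.1}.Finite := by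
  obtain ⟨U, hU, s, rfl⟩ := C.scheme.presheaf.exists_germ_eq (x := C.η) c
  exact (C.finite_closedPoints U hU).subset fun x hx hxU => hx (C.sectionToK_mem U hU hxU s)

theorem exists_inv_notMem (x : C.ClosedPoint) :
    ∃ t ∈ C.localRing x.1, t⁻¹ ∉ C.localRing x.1 := by
  obtain ⟨t, htm, ht0⟩ := Submodule.exists_mem_ne_zero_of_ne_bot
    (mt IsLocalRing.isField_iff_maximalIdeal_eq.mpr (C.not_isField_stalk x))
  refine ⟨C.toK x.1 t, C.toK_mem _ _, fun ⟨s, hs⟩ => htm ?_⟩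
  refine IsUnit.of_mul_eq_one s (C.toK_injective x.1 ?_)
  have hs : C.toK x.1 s = (C.toK x.1 t)⁻¹ := hs
  rw [map_mul, hs, map_one, mul_inv_cancel₀]
  exact (map_ne_zero_iff _ (C.toK_injective x.1)).mpr ht0

section Affine

variable {U : C.scheme.Opens}

theorem germ_mem_maximalIdeal_iff (hU : IsAffineOpen U) (x : U) (s : Γ(C.scheme, U)) :
    C.scheme.presheaf.germ U x.1 x.2 s ∈ maximalIdeal (C.scheme.presheaf.stalk x.1) ↔
      s ∈ (hU.primeIdealOf x).asIdeal :=
  letI := TopCat.Presheaf.algebra_section_stalk C.scheme.presheaf x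
  haveI := hU.isLocalization_stalk x
  IsLocalization.AtPrime.to_map_mem_maximal_iff (C.scheme.presheaf.stalk x.1)
    (hU.primeIdealOf x).asIdeal s

theorem primeIdealOf_injective (hU : IsAffineOpen U) : Function.Injective hU.primeIdealOf :=
  fun x y h => Subtype.ext (by rw [← hU.fromSpec_primeIdealOf x, h, hU.fromSpec_primeIdealOf y])

/-- The closed points of an affine open set are separated by functions. -/
theorem exists_separating (hU : IsAffineOpen U) {x : C.ClosedPoint} (hx : x.1 ∈ U)
    (T : Finset C.ClosedPoint) (hT : ∀ y ∈ T, y.1 ∈ U) (hxT : x ∉ T) :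
    ∃ g : C.K, (∀ y : C.ClosedPoint, y.1 ∈ U → g ∈ C.localRing y.1) ∧
      (∀ y ∈ T, Vanishes (C.localRing y.1) g) ∧ Vanishes (C.localRing x.1) (1 - g) := by
  classical
  have hη := genericPoint_mem U x.1 hx
  let m (y : T) : Ideal Γ(C.scheme, U) := (hU.primeIdealOf ⟨y.1.1, hT y y.2⟩).asIdeal
  let mx : Ideal Γ(C.scheme, U) := (hU.primeIdealOf ⟨x.1, hx⟩).asIdeal
  have hmx : mx.IsMaximal := hU.primeIdealOf_isMaximal_of_isClosed ⟨x.1, hx⟩ x.2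
  have hcop : IsCoprime mx (∏ y, m y) := by
    refine IsCoprime.prod_right fun y _ => ?_
    have hm : (m y).IsMaximal := hU.primeIdealOf_isMaximal_of_isClosed ⟨y.1.1, hT y y.2⟩ y.1.2
    refine Ideal.isCoprime_iff_sup_eq.mpr (hmx.coprime_of_ne hm fun h => hxT ?_)
    have h' := C.primeIdealOf_injective hU (PrimeSpectrum.ext h)
    have hxy : x = y.1 := Subtype.ext (congrArg (fun z : U => z.1) h')
    exact hxy ▸ y.2
  obtain ⟨a, ha, b, hb, hab⟩ := Ideal.isCoprime_iff_exists.mp hcop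
  refine ⟨C.sectionToK U hη b, fun y hy => C.sectionToK_mem U hη hy b, fun y hy => ?_, ?_⟩
  · rw [← C.toK_germ U hη (hT y hy)]
    refine C.vanishes_toK ((C.germ_mem_maximalIdeal_iff hU ⟨y.1, hT y hy⟩ b).mpr ?_)
    exact (Ideal.prod_le_inf.trans (Finset.inf_le (Finset.mem_univ (⟨y, hy⟩ : T)))) hb
  · rw [← map_one (C.sectionToK U hη), ← map_sub, ← hab, add_sub_cancel_right,
      ← C.toK_germ U hη hx]
    exact C.vanishes_toK ((C.germ_mem_maximalIdeal_iff hU ⟨x.1, hx⟩ a).mpr ha)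

theorem approx_affine (hU : IsAffineOpen U) :
    Approx (fun x : C.ClosedPoint => C.localRing x.1) {x | x.1 ∈ U} :=
  approx_of_separation C.finite_notMem_localRing fun _ hx T hT hxT =>
    C.exists_separating hU hx T hT hxT

theorem finiteType_section (hU : IsAffineOpen U) : Algebra.FiniteType k Γ(C.scheme, U) := by
  have h := C.str.finiteType_appLE (isAffineOpen_top _) hU le_top
  have h2 : RingHom.FiniteType
      (CommRingCat.Hom.hom ((Scheme.ΓSpecIso (.of k)).inv ≫ C.str.appTop ≫
        C.scheme.presheaf.map U.leTop.op)) := by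
    rw [CommRingCat.hom_comp]
    refine RingHom.FiniteType.comp h (RingHom.FiniteType.of_surjective _ ?_)
    exact (ConcreteCategory.bijective_of_isIso (Scheme.ΓSpecIso (.of k)).inv).2
  exact h2

/-- The residue field of a closed point is algebraic over `k`, by Hilbert's Nullstellensatz. -/
theorem exists_polynomial_vanishes (x : C.ClosedPoint) (c : C.K) (hc : c ∈ C.localRing x.1) :
    ∃ q : Polynomial k, q ≠ 0 ∧ Vanishes (C.localRing x.1) (Polynomial.aeval c q) := by
  obtain ⟨a, rfl⟩ := hc
  obtain ⟨U, hU, hxU, -⟩ := exists_isAffineOpen_mem_and_subset (U := ⊤) (x := x.1) trivial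
  let x' : U := ⟨x.1, hxU⟩
  let m := (hU.primeIdealOf x').asIdeal
  have hm : m.IsMaximal := hU.primeIdealOf_isMaximal_of_isClosed x' x.2
  have := C.finiteType_section hU
  let := Ideal.Quotient.field m
  have : Algebra.FiniteType k (Γ(C.scheme, U) ⧸ m) :=
    Algebra.FiniteType.of_surjective (Ideal.Quotient.mkₐ k m) Ideal.Quotient.mk_surjective
  have : Module.Finite k (Γ(C.scheme, U) ⧸ m) := finite_of_finite_type_of_isJacobsonRing _ _
  let gm : Γ(C.scheme, U) →ₐ[k] C.scheme.presheaf.stalk x.1 :=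
    { (C.scheme.presheaf.germ U x.1 hxU).hom with
      commutes' := fun c => (C.algebraMap_stalk U x.1 hxU c).symm }
  have hgm : ∀ s, gm s ∈ maximalIdeal (C.scheme.presheaf.stalk x.1) ↔ s ∈ m := fun s =>
    C.germ_mem_maximalIdeal_iff hU x' s
  obtain ⟨r, hr⟩ : ∃ r, gm r - a ∈ maximalIdeal (C.scheme.presheaf.stalk x.1) := by
    obtain ⟨r, s, hs, hrs⟩ : ∃ r s, s ∉ m ∧ a * gm s = gm r := by
      let := TopCat.Presheaf.algebra_section_stalk C.scheme.presheaf x'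
      have := hU.isLocalization_stalk x'
      obtain ⟨⟨r, s⟩, h⟩ := IsLocalization.surj m.primeCompl a
      exact ⟨r, s, s.2, h⟩
    obtain ⟨w, hw⟩ := hm.exists_inv hs
    refine ⟨w * r, ?_⟩
    obtain ⟨i, hi, h⟩ := hw
    have : gm (w * r) - a = - a * gm i := by
      rw [map_mul, ← hrs]
      have := congrArg gm h
      simp only [map_add, map_mul, map_one] at this
      linear_combination a * this
    rw [this]
    exact Ideal.mul_mem_left _ _ ((hgm i).mpr hi)
  obtain ⟨q, hq, hq'⟩ := Algebra.IsAlgebraic.isAlgebraic (R := k) (Ideal.Quotient.mkₐ k m r)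
  refine ⟨q, hq, ?_⟩
  change Vanishes _ (Polynomial.aeval (C.toK x.1 a) q)
  rw [Polynomial.aeval_algHom_apply]
  refine C.vanishes_toK ?_
  rw [Polynomial.aeval_algHom_apply] at hq'
  have h1 : Polynomial.aeval (gm r) q ∈ maximalIdeal (C.scheme.presheaf.stalk x.1) := by
    rw [Polynomial.aeval_algHom_apply, hgm]
    exact Ideal.Quotient.eq_zero_iff_mem.mp hq'
  have h2 : Polynomial.aeval (gm r) q - Polynomial.aeval a q ∈
      maximalIdeal (C.scheme.presheaf.stalk x.1) := by
    simp only [← Polynomial.eval_map_algebraMap]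
    exact Ideal.mem_of_dvd _ (Polynomial.sub_dvd_eval_sub _ _ _) hr
  rw [← sub_sub_cancel (Polynomial.aeval (gm r) q) (Polynomial.aeval a q)]
  exact Ideal.sub_mem _ h1 h2

end Affine

end LocalRings

end ProjectiveCurve

/-! ### Gluing inside the stalk at a generic point -/

section Gluing

variable {D : Type*} [Category.{u} D] {FD : D → D → Type*} {CD : D → Type u}
  [∀ X Y, FunLike (FD X Y) (CD X) (CD Y)] [ConcreteCategory.{u} D FD]
  [Limits.HasColimits D] [Limits.HasLimits D]
  [Limits.PreservesFilteredColimits (CategoryTheory.forget D)]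
  [Limits.PreservesLimits (CategoryTheory.forget D)]
  [(CategoryTheory.forget D).ReflectsIsomorphisms]
  {X : TopCat.{u}} (G : TopCat.Sheaf D X) {η : X} (hη : ∀ x, η ⤳ x)

/-- If all the maps from stalks to the stalk at the generic point are injective, then so are those
from sections. -/
theorem germ_generic_injective
    (hinj : ∀ x, Function.Injective (G.presheaf.stalkSpecializes (hη x))) (U : Opens X)
    (hU : η ∈ U) : Function.Injective (G.presheaf.germ U η hU) := by
  intro s t h
  refine TopCat.Presheaf.section_ext G U s t fun x hx => hinj x ?_
  rw [TopCat.Presheaf.germ_stalkSpecializes_apply, TopCat.Presheaf.germ_stalkSpecializes_apply]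
  exact h

/-- An element of the generic stalk which comes from every stalk over `U` comes from a section. -/
theorem exists_germ_generic_eq
    (hinj : ∀ x, Function.Injective (G.presheaf.stalkSpecializes (hη x))) (U : Opens X)
    (hU : η ∈ U) (a : ToType (G.presheaf.stalk η))
    (ha : ∀ x ∈ U, ∃ m, G.presheaf.stalkSpecializes (hη x) m = a) :
    ∃ s, G.presheaf.germ U η hU s = a := by
  have key : ∀ x : U, ∃ (V : Opens X) (hxV : x.1 ∈ V) (s : ToType (G.obj.obj (.op V))),
      V ≤ U ∧ G.presheaf.germ V η ((hη x).mem_open V.2 hxV) s = a := by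
    intro x
    obtain ⟨m, rfl⟩ := ha x x.2
    obtain ⟨V, hV, s, rfl⟩ := G.presheaf.exists_germ_eq m
    refine ⟨V ⊓ U, ⟨hV, x.2⟩, G.presheaf.map (homOfLE inf_le_left).op s, inf_le_right, ?_⟩
    rw [TopCat.Presheaf.germ_res_apply, TopCat.Presheaf.germ_stalkSpecializes_apply]
  choose V hxV s hVU hs using key
  obtain ⟨t, ht, -⟩ := G.existsUnique_gluing' V U (fun x => homOfLE (hVU x))
    (fun x hx => Opens.mem_iSup.mpr ⟨⟨x, hx⟩, hxV _⟩) s (fun x y => by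
      refine germ_generic_injective G hη hinj (V x ⊓ V y)
        ⟨(hη x).mem_open (V x).2 (hxV x), (hη y).mem_open (V y).2 (hxV y)⟩ ?_
      erw [TopCat.Presheaf.germ_res_apply, TopCat.Presheaf.germ_res_apply]
      rw [hs, hs])
  refine ⟨t, ?_⟩
  rw [← hs ⟨η, hU⟩, ← ht ⟨η, hU⟩, TopCat.Presheaf.germ_res_apply]

end Gluing

/-! ### Stalks of a sheaf of finite presentation -/

section FinitePresentation

open Limits Scheme.Modules

/-- A presentation of the restriction of `M` to `W`, as a module over the slice site of `W`, gives
one of its restriction to a smaller open subset `V`, as a module over the scheme `V`. -/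
def presentationOfLE {X : Scheme.{u}} (M : X.Modules) {V W : X.Opens} (h : V ≤ W)
    (P : (SheafOfModules.over M W).Presentation) : (M.restrict V.ι).Presentation :=
  have h₁ : PreservesColimitsOfSize.{u, u} (overEquiv W).functor := inferInstance
  have h₂ : PreservesColimitsOfSize.{u, u} (restrictFunctor (X.homOfLE h)) := inferInstance
  let G := (overEquiv W).functor ⋙ restrictFunctor (X.homOfLE h)
  have : PreservesColimitsOfSize.{u, u} G := @comp_preservesColimits _ _ _ _ _ _ _ _ h₁ h₂
  let e : SheafOfModules.overFunctor X.ringCatSheaf _ ⋙ G ≅ restrictFunctor V.ι :=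
    (Functor.associator _ _ _).symm ≪≫
      Functor.isoWhiskerRight (overFunctorEquiv _) _ ≪≫
      (restrictFunctorComp _ _).symm ≪≫ restrictFunctorCongr (X.homOfLE_ι h)
  -- `X.Modules` is not reducible to `SheafOfModules`, so the instances are passed explicitly.
  @SheafOfModules.Presentation.ofIsIso _ _ _ _ _ _ _ _ (e.app M).hom (Iso.isIso_hom (e.app M))
    (@SheafOfModules.Presentation.map _ _ _ _ _ _ _ _ _ _ _ _ _ P G this
      (restrictUnitIso _).symm)

theorem finite_presentationOfLE {X : Scheme.{u}} (M : X.Modules) {V W : X.Opens} (h : V ≤ W)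
    (P : (SheafOfModules.over M W).Presentation) [hP : Finite P.generators.I] :
    Finite (presentationOfLE M h P).generators.I :=
  hP

theorem exists_isAffineOpen_generators {X : Scheme.{u}} (M : X.Modules) [M.IsFinitePresentation]
    (x : X) : ∃ U : X.Opens, ∃ (_ : IsAffineOpen U) (_ : x ∈ U)
      (P : (M.restrict U.ι).Presentation), Finite P.generators.I := by
  obtain ⟨⟨I, W, cov, pres⟩, hfin⟩ :=
    SheafOfModules.IsFinitePresentation.exists_quasicoherentData (M := M)
  rw [Opens.coversTop_iff] at cov
  obtain ⟨i, hi⟩ : ∃ i, x ∈ W i := by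
    have : x ∈ ⨆ i, W i := cov ▸ trivial
    simpa using this
  obtain ⟨V, hV, hxV, hVW⟩ := exists_isAffineOpen_mem_and_subset hi
  have : Finite (pres i).generators.I :=
    (hfin.isFinite_presentation i).isFiniteType_generators.finite
  exact ⟨V, hV, hxV, presentationOfLE M hVW (pres i), finite_presentationOfLE M hVW (pres i)⟩

/-- Every point has an affine neighbourhood `U` such that the pull-back of `M` to the spectrum of
the ring of functions on `U` has a presentation with finitely many generators. -/
theorem exists_chart_generators {X : Scheme.{u}} (M : X.Modules) [M.IsFinitePresentation]
    (x : X) : ∃ U : X.Opens, ∃ (hU : IsAffineOpen U) (_ : x ∈ U)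
      (P : (M.restrict hU.fromSpec).Presentation), Finite P.generators.I := by
  obtain ⟨U, hU, hx, P, hP⟩ := exists_isAffineOpen_generators M x
  let e := (restrictFunctorComp hU.isoSpec.inv U.ι).app M
  exact ⟨U, hU, hx, @SheafOfModules.Presentation.ofIsIso _ _ _ _ _ _ _ _ e.inv (Iso.isIso_inv e)
    (presentationRestrict hU.isoSpec.inv P), hP⟩

theorem epi_iso_hom_comp_comp_iso_inv {C : Type*} [Category* C] {M N P Q : C} (e : M ≅ N)
    (f : N ⟶ P) (e' : Q ≅ P) (hf : Epi f) : Epi (e.hom ≫ f ≫ e'.inv) := inferInstance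

/-- On an affine scheme, the global sections of a sheaf with a presentation with finitely many
generators are finitely generated: the sheaf is the one associated to its global sections, and
the functor from modules to sheaves reflects epimorphisms. -/
theorem finite_moduleSpecΓ {R : CommRingCat.{u}} (M : (Spec R).Modules) (P : M.Presentation)
    [Finite P.generators.I] : Module.Finite R (moduleSpecΓFunctor.obj M) := by
  let e : _ ≅ M := @asIso _ _ _ _ _ (isIso_fromTildeΓ_of_presentation M P)
  let g : ModuleCat.of R (P.generators.I →₀ R) ⟶ moduleSpecΓFunctor.obj M :=
    (tilde.functor R).preimage ((tildeFinsupp _).hom ≫ P.generators.π ≫ e.inv)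
  have hg : Epi ((tilde.functor R).map g) := by
    rw [(tilde.functor R).map_preimage]
    exact epi_iso_hom_comp_comp_iso_inv (tildeFinsupp (R := R) P.generators.I) P.generators.π e
      P.generators.epi
  have := (tilde.functor R).epi_of_epi_map hg
  exact Module.Finite.of_surjective g.hom ((ModuleCat.epi_iff_surjective g).mp this)

/-- Finitely many sections over an affine chart generate all of them. -/
theorem exists_finset_chart {X : Scheme.{u}} (F : X.Modules) {R : CommRingCat.{u}}
    (j : Spec R ⟶ X) [IsOpenImmersion j] (P : (F.restrict j).Presentation)
    [Finite P.generators.I] : ∃ S : Finset Γ(F, j ''ᵁ ⊤), ∀ H : AddSubgroup Γ(F, j ''ᵁ ⊤),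
      (∀ r, ∀ m ∈ H, chartFun j ⊤ r • m ∈ H) → (∀ m ∈ S, m ∈ H) → ∀ m, m ∈ H := by
  obtain ⟨S, hS⟩ := (finite_moduleSpecΓ _ P).fg_top
  refine ⟨S, fun H hH hSH m => ?_⟩
  let H' : Submodule R (moduleSpecΓFunctor.obj (F.restrict j)) :=
    { carrier := {m | m ∈ H}
      add_mem' := H.add_mem
      zero_mem' := H.zero_mem
      smul_mem' := hH }
  have : Submodule.span R (S : Set (moduleSpecΓFunctor.obj (F.restrict j))) ≤ H' :=
    Submodule.span_le.mpr hSH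
  rw [hS] at this
  exact this (show m ∈ (⊤ : Submodule R (moduleSpecΓFunctor.obj (F.restrict j))) from trivial)

theorem isUnit_res_of_le_basicOpen {X : Scheme.{u}} (s : Γ(X, ⊤)) {U : X.Opens}
    (hU : U ≤ X.basicOpen s) : IsUnit (X.presheaf.map U.leTop.op s) := by
  have h := (X.toRingedSpace.isUnit_res_basicOpen s).map (X.presheaf.map (homOfLE hU).op).hom
  have e : U.leTop = homOfLE hU ≫ homOfLE (X.basicOpen_le s) := rfl
  rw [e, op_comp, X.presheaf.map_comp, CommRingCat.comp_apply]
  exact h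

theorem isUnit_chartFun {X : Scheme.{u}} {R : CommRingCat.{u}} (j : Spec R ⟶ X)
    [IsOpenImmersion j] (f : R) (n : ℕ) :
    IsUnit (chartFun j (PrimeSpectrum.basicOpen f) (f ^ n)) := by
  have h : chartFun j (PrimeSpectrum.basicOpen f) (f ^ n) =
      chartFun j (PrimeSpectrum.basicOpen f) f ^ n := by
    simp only [chartFun, map_pow]
  rw [h]
  refine IsUnit.pow n (IsUnit.map (j.appIso (PrimeSpectrum.basicOpen f)).inv.hom ?_)
  exact isUnit_res_of_le_basicOpen _ (basicOpen_eq_of_affine f).ge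

/-- The stalks of a sheaf of finite presentation are finitely generated. -/
theorem finite_stalk {X : Scheme.{u}} (F : X.Modules) [F.IsFinitePresentation] (x : X) :
    Module.Finite (X.presheaf.stalk x) (Stalk F x) := by
  obtain ⟨U, hU, hxU, P, hP⟩ := exists_chart_generators F x
  obtain ⟨y, rfl⟩ : ∃ y, hU.fromSpec y = x := hU.range_fromSpec.ge hxU
  have hx : hU.fromSpec y ∈ hU.fromSpec ''ᵁ (⊤) := ⟨y, trivial, rfl⟩
  obtain ⟨S, hS⟩ := exists_finset_chart F hU.fromSpec P
  classical
  let G : Γ(F, hU.fromSpec ''ᵁ ⊤) →+ Stalk F (hU.fromSpec y) := germ F _ _ hx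
  let N : Submodule (X.presheaf.stalk (hU.fromSpec y)) (Stalk F (hU.fromSpec y)) :=
    Submodule.span _ (S.image G : Set (Stalk F (hU.fromSpec y)))
  have key : ∀ m, G m ∈ N := by
    refine hS (N.toAddSubgroup.comap G) (fun r m hm => ?_) fun m hm =>
      Submodule.subset_span (Finset.mem_image_of_mem G hm)
    have : G (chartFun hU.fromSpec ⊤ r • m) = _ := germ_smul F _ _ hx _ _
    exact (this.symm ▸ N.smul_mem _ hm : G _ ∈ N)
  refine ⟨⟨S.image G, eq_top_iff.mpr fun a _ => ?_⟩⟩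
  change a ∈ N
  obtain ⟨V, hV, s, rfl⟩ := exists_germ F _ a
  obtain ⟨_, ⟨_, ⟨f, rfl⟩, rfl⟩, hzf, hf⟩ :=
    PrimeSpectrum.isBasis_basic_opens.exists_subset_of_mem_open
      (show y ∈ (hU.fromSpec ⁻¹ᵁ V : Set _) from hV) (hU.fromSpec ⁻¹ᵁ V).2
  have hfV : hU.fromSpec ''ᵁ (PrimeSpectrum.basicOpen f) ≤ V := by
    rintro _ ⟨w, hw, rfl⟩
    exact hf hw
  have hf' : hU.fromSpec y ∈ hU.fromSpec ''ᵁ (PrimeSpectrum.basicOpen f) := ⟨y, hzf, rfl⟩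
  obtain ⟨n, m, hm⟩ := chart_surj hU.fromSpec F f (F.presheaf.map (homOfLE hfV).op s)
  have h1 := congr(germ F _ (hU.fromSpec y) hf' $hm)
  rw [germ_smul, germ_res F (homOfLE hfV)] at h1
  have h2 : G m = _ := (germ_res F
    (hU.fromSpec.opensFunctor.map (PrimeSpectrum.basicOpen f).leTop) _ hf' m).symm.trans h1
  obtain ⟨v, hv⟩ := (isUnit_chartFun hU.fromSpec f n).map
    (X.presheaf.germ _ (hU.fromSpec y) hf').hom
  have h3 := N.smul_mem (↑v⁻¹ : X.presheaf.stalk (hU.fromSpec y)) (key m)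
  rw [h2] at h3
  erw [← hv, smul_smul, Units.inv_mul, one_smul] at h3
  exact h3

end FinitePresentation

/-! ### Torsion-free sheaves -/

section TorsionFree

variable {X : Scheme.{u}} [IsIntegral X] (F : X.Modules) [F.IsQuasicoherent]

/-- The stalks of a torsion-free sheaf embed into the generic stalk, which is a localization. -/
theorem specialize_injective (hF : IsTorsionFree F) (x : X) :
    Function.Injective (specialize F (genericPoint_specializes x)) := by
  refine (injective_iff_map_eq_zero _).mpr fun a ha => ?_
  obtain ⟨g, hg, h⟩ := exists_smul_eq_zero F x a ha
  have := hF x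
  exact (smul_eq_zero_iff_right hg).mp h

theorem germ_η_injective (hF : IsTorsionFree F) (U : X.Opens) (hU : genericPoint X ∈ U) :
    Function.Injective (germ F U (genericPoint X) hU) :=
  germ_generic_injective ⟨F.presheaf, F.isSheaf⟩ genericPoint_specializes
    (specialize_injective F hF) U hU

theorem exists_germ_η_eq (hF : IsTorsionFree F) (U : X.Opens) (hU : genericPoint X ∈ U)
    (a : Stalk F (genericPoint X))
    (ha : ∀ x ∈ U, ∃ m, specialize F (genericPoint_specializes x) m = a) :
    ∃ s, germ F U (genericPoint X) hU s = a :=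
  exists_germ_generic_eq ⟨F.presheaf, F.isSheaf⟩ genericPoint_specializes
    (specialize_injective F hF) U hU a ha

end TorsionFree

/-! ### Valuation rings of the function field have a centre -/

namespace ProjectiveCurve

section Center

variable {k : Type u} [Field k] (C : ProjectiveCurve k)

attribute [local instance] MvPolynomial.gradedAlgebra in
instance : UniversallyClosed C.str := by
  obtain ⟨n, i, hi, h⟩ := C.projective
  rw [← h]
  have : IsClosedImmersion (Spec.map (CommRingCat.ofHom
      (algebraMap k (MvPolynomial.homogeneousSubmodule (Fin (n + 1)) k 0)))) := by
    refine IsClosedImmersion.spec_of_surjective _ ?_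
    rintro ⟨p, hp⟩
    rw [MvPolynomial.homogeneousSubmodule_zero, Submodule.mem_one] at hp
    obtain ⟨c, hc⟩ := hp
    exact ⟨c, Subtype.ext hc⟩
  unfold ProjSpace.str
  infer_instance

theorem fromSpecStalk_str :
    C.scheme.fromSpecStalk C.η ≫ C.str =
      Spec.map (CommRingCat.ofHom (algebraMap k (C.scheme.presheaf.stalk C.η))) := by
  refine ext_to_Spec ?_
  change (Scheme.ΓSpecIso (.of k)).inv ≫ (C.scheme.fromSpecStalk C.η ≫ C.str).appTop =
    (Scheme.ΓSpecIso (.of k)).inv ≫ (Spec.map _).appTop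
  rw [Scheme.Hom.comp_appTop, Scheme.fromSpecStalk_appTop, ← Scheme.ΓSpecIso_inv_naturality]
  have h1 : CommRingCat.ofHom (algebraMap k (C.scheme.presheaf.stalk C.η)) =
      (Scheme.ΓSpecIso (.of k)).inv ≫ C.str.appTop ≫ C.scheme.presheaf.germ ⊤ C.η trivial := by
    ext c
    exact (C.algebraMap_stalk ⊤ C.η trivial c).trans (TopCat.Presheaf.germ_res_apply _ _ _ _ _)
  rw [h1]
  have h2 : (Spec (C.scheme.presheaf.stalk C.η)).presheaf.map (homOfLE le_top).op = 𝟙 _ :=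
    (Spec (C.scheme.presheaf.stalk C.η)).presheaf.map_id _
  rw [h2]
  simp only [Category.assoc, Category.comp_id]

/-- The valuative criterion of properness, for valuation rings of the function field. -/
theorem exists_center (V : ValuationSubring C.K) (hV : ∀ c : k, algebraMap k C.K c ∈ V) :
    ∃ x : C.scheme, (∀ c ∈ C.localRing x, c ∈ V) ∧
      ∀ t ∈ maximalIdeal (C.scheme.presheaf.stalk x), C.toK x t ≠ 0 → (C.toK x t)⁻¹ ∉ V := by
  have hex : ValuativeCriterion.Existence C.str := by
    have : UniversallyClosed C.str := inferInstance
    rw [UniversallyClosed.eq_valuativeCriterion] at this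
    exact this.1
  let φ : k →+* V := (algebraMap k C.K).codRestrict V hV
  let S : ValuativeCommSq C.str :=
    { R := V
      K := C.K
      i₁ := C.scheme.fromSpecStalk C.η
      i₂ := Spec.map (CommRingCat.ofHom φ)
      commSq := ⟨by
        rw [C.fromSpecStalk_str, ← Spec.map_comp]
        rfl⟩ }
  obtain ⟨l, hl, -⟩ := (hex S).exists_lift
  let l : Spec (.of V) ⟶ C.scheme := l
  have hl : Spec.map (CommRingCat.ofHom (algebraMap V C.K)) ≫ l = C.scheme.fromSpecStalk C.η := hl
  let x := l (closedPoint V)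
  let ψ : C.scheme.presheaf.stalk x ⟶ .of V := Scheme.stalkClosedPointTo l
  have hψ : ψ ≫ CommRingCat.ofHom (algebraMap V C.K) =
      C.scheme.presheaf.stalkSpecializes (genericPoint_specializes x) := by
    refine Spec.map_injective ?_
    rw [← cancel_mono (C.scheme.fromSpecStalk x), Scheme.SpecMap_stalkSpecializes_fromSpecStalk,
      Spec.map_comp, Category.assoc, Scheme.Spec_stalkClosedPointTo_fromSpecStalk]
    exact hl
  have hψ' : ∀ a, C.toK x a = (ψ a : C.K) := fun a => congr($hψ.symm a)
  refine ⟨x, ?_, fun t ht ht0 h => ht ?_⟩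
  · rintro _ ⟨a, rfl⟩
    change C.toK x a ∈ V
    rw [hψ']
    exact (ψ a).2
  · have : IsLocalHom ψ.hom := inferInstance
    refine isUnit_of_map_unit ψ.hom t (IsUnit.of_mul_eq_one (⟨_, h⟩ : V) (Subtype.ext ?_))
    change (ψ t : C.K) * (C.toK x t)⁻¹ = 1
    rw [← hψ', mul_inv_cancel₀ ht0]

end Center

end ProjectiveCurve

/-! ### Homogeneous functions on projective schemes -/

section Graded

variable {σ A : Type u} [CommRing A] [SetLike σ A] [AddSubgroupClass σ A] (𝒜 : ℕ → σ)
  [GradedRing 𝒜]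

theorem exists_homogeneous_mem_notMem {x y : ProjectiveSpectrum 𝒜} (h : ¬ y ≤ x) :
    ∃ (d : ℕ) (a : A), a ∈ 𝒜 d ∧ a ∈ y.asHomogeneousIdeal ∧ a ∉ x.asHomogeneousIdeal := by
  classical
  obtain ⟨a, hay, hax⟩ := Set.not_subset.mp h
  by_contra! hcon
  refine hax ?_
  change a ∈ x.asHomogeneousIdeal
  rw [← DirectSum.sum_support_decompose 𝒜 a]
  exact sum_mem fun i _ => hcon i _ (SetLike.coe_mem _) (y.asHomogeneousIdeal.isHomogeneous i hay)

theorem exists_homogeneous_pos_notMem (x : ProjectiveSpectrum 𝒜) :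
    ∃ (d : ℕ) (a : A), 0 < d ∧ a ∈ 𝒜 d ∧ a ∉ x.asHomogeneousIdeal := by
  have h := x.not_irrelevant_le
  rw [HomogeneousIdeal.irrelevant_le] at h
  push Not at h
  obtain ⟨d, hd, h⟩ := h
  obtain ⟨a, ha, hax⟩ := Set.not_subset.mp h
  exact ⟨d, a, hd, ha, hax⟩

/-- Homogeneous prime avoidance: a homogeneous function of positive degree which does not vanish at
any of finitely many given points, none of which specializes to another. -/
theorem exists_homogeneous_forall_notMem (S : Finset (ProjectiveSpectrum 𝒜))
    (hS : ∀ x ∈ S, ∀ y ∈ S, y ≤ x → y = x) :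
    ∃ (d : ℕ) (g : A), 0 < d ∧ g ∈ 𝒜 d ∧ ∀ x ∈ S, g ∉ x.asHomogeneousIdeal := by
  classical
  induction S using Finset.induction_on with
  | empty => exact ⟨1, 0, one_pos, zero_mem _, by simp⟩
  | insert x S hx ih =>
    obtain ⟨m, g, hm, hg, hgS⟩ := ih fun x hx y hy =>
      hS x (Finset.mem_insert_of_mem hx) y (Finset.mem_insert_of_mem hy)
    by_cases hgx : g ∈ x.asHomogeneousIdeal
    swap
    · exact ⟨m, g, hm, hg, Finset.forall_mem_insert _ _ _ |>.mpr ⟨hgx, hgS⟩⟩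
    have key : ∀ y : S, ∃ (d : ℕ) (a : A), a ∈ 𝒜 d ∧ a ∈ y.1.asHomogeneousIdeal ∧
        a ∉ x.asHomogeneousIdeal := fun y => exists_homogeneous_mem_notMem 𝒜 fun hle => hx
      (hS x (Finset.mem_insert_self _ _) y (Finset.mem_insert_of_mem y.2) hle ▸ y.2)
    choose d a ha hay hax using key
    obtain ⟨e, b, he, hb, hbx⟩ := exists_homogeneous_pos_notMem 𝒜 x
    let c := b * ∏ y, a y
    have hc : c ∈ 𝒜 (e + ∑ y, d y) :=
      SetLike.mul_mem_graded hb (SetLike.prod_mem_graded 𝒜 d a fun y _ => ha y)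
    have hcx : c ∉ x.asHomogeneousIdeal := fun h => by
      rcases x.isPrime.mem_or_mem h with h | h
      · exact hbx h
      · obtain ⟨y, -, hy⟩ := x.isPrime.prod_mem_iff.mp h
        exact hax y hy
    have hcS : ∀ y ∈ S, c ∈ y.asHomogeneousIdeal := fun y hy =>
      y.asHomogeneousIdeal.toIdeal.mul_mem_left b
        (y.asHomogeneousIdeal.toIdeal.prod_mem (Finset.mem_univ ⟨y, hy⟩) (hay ⟨y, hy⟩))
    set n := e + ∑ y, d y with hn
    have hn0 : 0 < n := by omega
    refine ⟨m * n, g ^ n + c ^ m, Nat.mul_pos hm hn0, add_mem ?_ ?_,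
      Finset.forall_mem_insert _ _ _ |>.mpr ⟨fun h => ?_, fun y hy h => ?_⟩⟩
    · rw [mul_comm, ← smul_eq_mul]
      exact SetLike.pow_mem_graded n hg
    · rw [← smul_eq_mul]
      exact SetLike.pow_mem_graded m hc
    · have h1 : g ^ n ∈ x.asHomogeneousIdeal.toIdeal := Ideal.pow_mem_of_mem _ hgx n hn0
      exact hcx (x.isPrime.mem_of_pow_mem m ((Ideal.add_mem_iff_right _ h1).mp h))
    · have h1 : c ^ m ∈ y.asHomogeneousIdeal.toIdeal := Ideal.pow_mem_of_mem _ (hcS y hy) m hm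
      exact hgS y hy (y.isPrime.mem_of_pow_mem n ((Ideal.add_mem_iff_left _ h1).mp h))

open HomogeneousLocalization

variable {𝒜}

/-- The function `g ^ d / f ^ e` on `D₊(f)`, for `f` of degree `d` and `g` of degree `e`. -/
def ratio {d e : ℕ} {f g : A} (hf : f ∈ 𝒜 d) (hg : g ∈ 𝒜 e) :
    Γ(Proj 𝒜, Proj.basicOpen 𝒜 f) :=
  Proj.awayToSection 𝒜 f (Away.isLocalizationElem hf hg)

/-- The germ at `x` of `g ^ d / f ^ e`, as an element of the homogeneous localization. -/
theorem stalkIso_germ_ratio {d e : ℕ} {f g : A} (hf : f ∈ 𝒜 d) (hg : g ∈ 𝒜 e)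
    (x : ProjectiveSpectrum 𝒜) (hx : x ∈ Proj.basicOpen 𝒜 f) :
    (Proj.stalkIso' 𝒜 x
      ((Proj 𝒜).presheaf.germ _ x hx (ratio hf hg))).val =
      Localization.mk (g ^ d) (⟨f ^ e, fun h => hx (x.isPrime.mem_of_pow_mem e h)⟩ :
        x.asHomogeneousIdeal.toIdeal.primeCompl) := by
  have h := Proj.stalkIso'_germ 𝒜 (ProjectiveSpectrum.basicOpen 𝒜 f) x hx
    (ProjectiveSpectrum.Proj.awayToSection 𝒜 f (Away.isLocalizationElem hf hg))
  refine (congrArg HomogeneousLocalization.val h).trans ?_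
  refine (ProjectiveSpectrum.Proj.awayToSection_apply 𝒜 f _ ⟨x, hx⟩).trans ?_
  rw [Away.isLocalizationElem, Away.val_mk, Localization.mk_eq_mk', IsLocalization.map_mk',
    ← Localization.mk_eq_mk']
  rfl

theorem germ_ratio_mul {d e : ℕ} {f g : A} (hf : f ∈ 𝒜 d) (hg : g ∈ 𝒜 e) (x : Proj 𝒜)
    (hx : x ∈ Proj.basicOpen 𝒜 f) (hx' : x ∈ Proj.basicOpen 𝒜 g) :
    (Proj 𝒜).presheaf.germ _ x hx (ratio hf hg) * (Proj 𝒜).presheaf.germ _ x hx' (ratio hg hf) =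
      1 := by
  refine (Proj.stalkIso' 𝒜 x).injective (val_injective _ ?_)
  refine (congrArg HomogeneousLocalization.val (map_mul _ _ _)).trans ?_
  rw [val_mul]
  erw [stalkIso_germ_ratio hf hg x hx, stalkIso_germ_ratio hg hf x hx']
  refine Eq.trans ?_ (congrArg HomogeneousLocalization.val
    (map_one (Proj.stalkIso' 𝒜 x))).symm
  rw [val_one, Localization.mk_mul, ← Localization.mk_one, Localization.mk_eq_mk_iff,
    Localization.r_iff_exists]
  exact ⟨1, by simp; ring⟩

theorem not_isUnit_germ_ratio {d e : ℕ} {f g : A} (hf : f ∈ 𝒜 d) (hg : g ∈ 𝒜 e) (hd : 0 < d)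
    (x : Proj 𝒜) (hx : x ∈ Proj.basicOpen 𝒜 f) (hx' : x ∉ Proj.basicOpen 𝒜 g) :
    ¬ IsUnit ((Proj 𝒜).presheaf.germ _ x hx (ratio hf hg)) := by
  intro h
  have h1 := h.map (Proj.stalkIso' 𝒜 x)
  have hp : x.asHomogeneousIdeal.toIdeal.IsPrime := x.isPrime
  have h2 := h1.map (algebraMap _ (Localization.AtPrime x.asHomogeneousIdeal.toIdeal))
  rw [HomogeneousLocalization.algebraMap_apply] at h2
  erw [stalkIso_germ_ratio hf hg x hx] at h2
  rw [Localization.mk_eq_mk',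
    IsLocalization.AtPrime.isUnit_mk'_iff _ x.asHomogeneousIdeal.toIdeal] at h2
  exact h2 (Ideal.pow_mem_of_mem _ (not_not.mp hx') d hd)

end Graded

/-! ### Two affine charts of a projective curve -/

namespace ProjectiveCurve

section Charts

variable {k : Type u} [Field k] (C : ProjectiveCurve k)

attribute [local instance] MvPolynomial.gradedAlgebra in
/-- A projective curve is covered by two affine open sets `U₁`, `U₂`, the loci where two
homogeneous functions do not vanish. A quotient `y` of powers of the same degree of these two is
regular on `U₂` with zeros precisely outside of `U₁`, and vice versa for `y⁻¹`. -/
theorem exists_charts (P : C.ClosedPoint) : ∃ (U₁ U₂ : C.scheme.Opens) (y : C.K),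
    IsAffineOpen U₁ ∧ IsAffineOpen U₂ ∧ (∀ x, x ∈ U₁ ∨ x ∈ U₂) ∧ C.η ∈ U₁ ∧ C.η ∈ U₂ ∧ y ≠ 0 ∧
      (∀ x ∈ U₂, y ∈ C.localRing x) ∧ (∀ x ∈ U₁, y⁻¹ ∈ C.localRing x) ∧
      (∀ x ∈ U₂, x ∉ U₁ → ∃ t ∈ maximalIdeal (C.scheme.presheaf.stalk x), C.toK x t = y) ∧
      (∀ x ∈ U₁, x ∉ U₂ → ∃ t ∈ maximalIdeal (C.scheme.presheaf.stalk x), C.toK x t = y⁻¹) := by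
  classical
  obtain ⟨n, i, hi, -⟩ := C.projective
  let 𝒜 := MvPolynomial.homogeneousSubmodule (Fin (n + 1)) k
  -- The points of `Proj` also carry the specialization order of a scheme; `j` selects inclusion.
  let j : C.scheme → ProjectiveSpectrum 𝒜 := fun x => i x
  have hle (x y : C.ClosedPoint) (h : j y.1 ≤ j x.1) : y = x := by
    rw [ProjectiveSpectrum.le_iff_mem_closure] at h
    have h1 : i y.1 ⤳ i x.1 := specializes_iff_mem_closure.mpr h
    have h2 : y.1 ⤳ x.1 := i.isEmbedding.isInducing.specializes_iff.mp h1
    have h3 : x.1 ∈ ({y.1} : Set C.scheme) := h2.mem_closed y.2 (Set.mem_singleton _)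
    exact Subtype.ext (Set.mem_singleton_iff.mp h3).symm
  have choice (S : Finset C.ClosedPoint) : ∃ (d : ℕ) (g : MvPolynomial (Fin (n + 1)) k),
      0 < d ∧ g ∈ 𝒜 d ∧ ∀ x ∈ S, x.1 ∈ i ⁻¹ᵁ Proj.basicOpen 𝒜 g := by
    obtain ⟨d, g, hd, hg, h⟩ := exists_homogeneous_forall_notMem 𝒜
      (S.image fun x => j x.1) (by
        intro a ha b hb h
        obtain ⟨x, -, rfl⟩ := Finset.mem_image.mp ha
        obtain ⟨y, -, rfl⟩ := Finset.mem_image.mp hb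
        rw [hle x y h])
    exact ⟨d, g, hd, hg, fun x hx => h _ (Finset.mem_image_of_mem _ hx)⟩
  have affine {d : ℕ} {g : MvPolynomial (Fin (n + 1)) k} (hd : 0 < d) (hg : g ∈ 𝒜 d) :
      IsAffineOpen (i ⁻¹ᵁ Proj.basicOpen 𝒜 g) :=
    (Proj.isAffineOpen_basicOpen 𝒜 g hg hd).preimage i
  obtain ⟨d, g, hd, hg, hP⟩ := choice {P}
  have hη₁ : C.η ∈ i ⁻¹ᵁ Proj.basicOpen 𝒜 g :=
    genericPoint_mem _ P.1 (hP P (Finset.mem_singleton_self P))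
  -- `f` does not vanish at the finitely many points where `g` does, so the two loci cover.
  obtain ⟨e, f, he, hf, hS⟩ := choice (insert P (C.finite_closedPoints _ hη₁).toFinset)
  have hη₂ : C.η ∈ i ⁻¹ᵁ Proj.basicOpen 𝒜 f :=
    genericPoint_mem _ P.1 (hS P (Finset.mem_insert_self P _))
  set U₁ := i ⁻¹ᵁ Proj.basicOpen 𝒜 g with hU₁
  set U₂ := i ⁻¹ᵁ Proj.basicOpen 𝒜 f with hU₂
  let s₁ : Γ(C.scheme, U₁) := i.app _ (ratio hg hf)
  let s₂ : Γ(C.scheme, U₂) := i.app _ (ratio hf hg)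
  have hmul : C.sectionToK U₁ hη₁ s₁ * C.sectionToK U₂ hη₂ s₂ = 1 := by
    have h := congrArg (i.stalkMap C.η) (germ_ratio_mul hg hf (i C.η) hη₁ hη₂)
    rw [map_mul, map_one] at h
    erw [Scheme.Hom.germ_stalkMap_apply, Scheme.Hom.germ_stalkMap_apply] at h
    exact h
  have hy : C.sectionToK U₂ hη₂ s₂ ≠ 0 := right_ne_zero_of_mul_eq_one hmul
  have hy' : C.sectionToK U₁ hη₁ s₁ = (C.sectionToK U₂ hη₂ s₂)⁻¹ := eq_inv_of_mul_eq_one_left hmul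
  have hnonunit {d e : ℕ} {f g : MvPolynomial (Fin (n + 1)) k} (hf : f ∈ 𝒜 d) (hg : g ∈ 𝒜 e)
      (hd : 0 < d) (x : C.scheme) (hx : x ∈ i ⁻¹ᵁ Proj.basicOpen 𝒜 f)
      (hx' : x ∉ i ⁻¹ᵁ Proj.basicOpen 𝒜 g) :
      C.scheme.presheaf.germ _ x hx (i.app _ (ratio hf hg)) ∈ maximalIdeal _ := by
    refine fun h => not_isUnit_germ_ratio hf hg hd (i x) hx hx' ?_
    erw [← Scheme.Hom.germ_stalkMap_apply] at h
    exact isUnit_of_map_unit (i.stalkMap x).hom _ h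
  refine ⟨U₁, U₂, C.sectionToK U₂ hη₂ s₂, affine hd hg, affine he hf, fun x => ?_, hη₁, hη₂, hy,
    fun x hx => C.sectionToK_mem _ hη₂ hx _, fun x hx => hy' ▸ C.sectionToK_mem _ hη₁ hx _,
    fun x hx hx' => ⟨_, hnonunit hf hg he x hx hx', C.toK_germ _ _ _ _⟩,
    fun x hx hx' => ⟨_, hnonunit hg hf hd x hx hx', (C.toK_germ _ _ _ _).trans hy'⟩⟩
  by_cases hx : x = C.η
  · exact Or.inl (hx ▸ hη₁)
  · refine or_iff_not_imp_left.mpr fun hx' => hS ⟨x, C.isClosed_of_ne_η hx⟩ ?_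
    exact Finset.mem_insert_of_mem ((Set.Finite.mem_toFinset _).mpr hx')

end Charts

end ProjectiveCurve

/-! ### Strong approximation on a projective curve -/

namespace ProjectiveCurve

section Approximation

variable {k : Type u} [Field k] (C : ProjectiveCurve k)

/-- A rational function which is regular at all points of `U` is a section over `U`. -/
theorem exists_sectionToK_eq (U : C.scheme.Opens) (hU : C.η ∈ U) (c : C.K)
    (hc : ∀ x : C.ClosedPoint, x.1 ∈ U → c ∈ C.localRing x.1) :
    ∃ s, C.sectionToK U hU s = c := by
  refine exists_germ_generic_eq C.scheme.sheaf (η := C.η) genericPoint_specializes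
    (fun x => C.toK_injective x) U hU c fun x hx => ?_
  by_cases hxη : x = C.η
  · subst hxη
    refine ⟨c, ?_⟩
    rw [TopCat.Presheaf.stalkSpecializes_refl]
    rfl
  · exact hc ⟨x, C.isClosed_of_ne_η hxη⟩ hx

/-- The functions on an affine open set `U₂` are finite over `k[y]` if `y` is regular on `U₂` and
has a pole everywhere outside. By the valuative criterion, every valuation ring of the function
field that contains `y` has its centre on `U₂`, so the functions on `U₂` are integral over
`k[y]`. -/
theorem exists_finset_span {U₁ U₂ : C.scheme.Opens} {y : C.K} (hU₂ : IsAffineOpen U₂)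
    (hcov : ∀ x, x ∈ U₁ ∨ x ∈ U₂) (hη : C.η ∈ U₂) (hy : y ≠ 0)
    (hy₂ : ∀ x ∈ U₂, y ∈ C.localRing x)
    (hy₁ : ∀ x ∈ U₁, x ∉ U₂ → ∃ t ∈ maximalIdeal (C.scheme.presheaf.stalk x), C.toK x t = y⁻¹) :
    ∃ s : Finset C.K, (∀ e ∈ s, ∀ x ∈ U₂, e ∈ C.localRing x) ∧
      ∀ b : C.K, (∀ x : C.ClosedPoint, x.1 ∈ U₂ → b ∈ C.localRing x.1) →
        b ∈ Submodule.span k {z | ∃ i : ℕ, ∃ e ∈ s, z = y ^ i * e} := by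
  classical
  let B := Algebra.adjoin k {y}
  have hint (a : Γ(C.scheme, U₂)) : IsIntegral B (C.sectionToK U₂ hη a) := by
    have h : C.sectionToK U₂ hη a ∈
        (⨅ V : {V : ValuationSubring C.K // (B : Set C.K) ⊆ V.toSubring}, V.1.toSubring) := by
      rw [Subring.mem_iInf]
      rintro ⟨V, hV⟩
      obtain ⟨x, hx, hx'⟩ := C.exists_center V fun c => hV (B.algebraMap_mem c)
      have hxU : x ∈ U₂ := by
        by_contra hxU
        obtain ⟨t, ht, hty⟩ := hy₁ x ((hcov x).resolve_right hxU) hxU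
        refine hx' t ht (hty ▸ inv_ne_zero hy) ?_
        rw [hty, inv_inv]
        exact hV (Algebra.self_mem_adjoin_singleton k y)
      exact hx _ (C.sectionToK_mem U₂ hη hxU a)
    rw [iInf_valuationSubring_superset] at h
    have h : IsIntegral (Subring.closure (B : Set C.K)) (C.sectionToK U₂ hη a) := h
    have hB : Subring.closure (B : Set C.K) = B.toSubring := Subring.closure_eq B.toSubring
    rw [hB] at h
    exact h
  obtain ⟨S, hS⟩ := (C.finiteType_section hU₂).out
  let S' := S.image (C.sectionToK U₂ hη)
  have hfg := fg_adjoin_of_finite (R := B) S'.finite_toSet fun z hz => by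
    obtain ⟨a, -, rfl⟩ := Finset.mem_image.mp hz
    exact hint a
  have hB (x) (hx : x ∈ U₂) : B ≤ C.localRing x :=
    Algebra.adjoin_le (Set.singleton_subset_iff.mpr (hy₂ x hx))
  obtain ⟨s, hs⟩ := hfg
  refine ⟨s, fun e he x hx => ?_, fun b hb => ?_⟩
  · have h1 : e ∈ Algebra.adjoin B (S' : Set C.K) := by
      rw [← Subalgebra.mem_toSubmodule, ← hs]
      exact Submodule.subset_span he
    clear he
    induction h1 using Algebra.adjoin_induction with
    | mem z hz =>
      obtain ⟨a, -, rfl⟩ := Finset.mem_image.mp hz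
      exact C.sectionToK_mem U₂ hη hx a
    | algebraMap r => exact hB x hx r.2
    | add _ _ _ _ h1 h2 => exact add_mem h1 h2
    | mul _ _ _ _ h1 h2 => exact mul_mem h1 h2
  · have hyspan : ∀ z ∈ Submodule.span k {z | ∃ i : ℕ, ∃ e ∈ s, z = y ^ i * e},
        y * z ∈ Submodule.span k {z | ∃ i : ℕ, ∃ e ∈ s, z = y ^ i * e} := by
      intro z hz
      refine (Submodule.span_le.mpr ?_ : _ ≤ (Submodule.span k _).comap (LinearMap.mulLeft k y)) hz
      rintro _ ⟨i, e, he, rfl⟩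
      exact Submodule.subset_span ⟨i + 1, e, he, by simp [pow_succ']; ring⟩
    have hBspan : ∀ r ∈ B, ∀ z ∈ Submodule.span k {z | ∃ i : ℕ, ∃ e ∈ s, z = y ^ i * e},
        r * z ∈ Submodule.span k {z | ∃ i : ℕ, ∃ e ∈ s, z = y ^ i * e} := by
      intro r hr
      induction hr using Algebra.adjoin_induction with
      | mem r hr =>
        obtain rfl : r = y := hr
        exact hyspan
      | algebraMap c => exact fun z h => Algebra.smul_def c z ▸ Submodule.smul_mem _ c h
      | add a b _ _ ha hb => exact fun z h => add_mul a b z ▸ add_mem (ha z h) (hb z h)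
      | mul a b _ _ ha hb => exact fun z h => mul_assoc a b z ▸ ha _ (hb z h)
    obtain ⟨a, rfl⟩ := C.exists_sectionToK_eq U₂ hη b hb
    clear hb
    have h1 : C.sectionToK U₂ hη a ∈ Algebra.adjoin k (S' : Set C.K) := by
      have h2 : a ∈ Algebra.adjoin k (S : Set Γ(C.scheme, U₂)) := hS ▸ trivial
      rw [Finset.coe_image, ← AlgHom.map_adjoin]
      exact ⟨a, h2, rfl⟩
    generalize C.sectionToK U₂ hη a = b at h1 ⊢
    have h2 : b ∈ Algebra.adjoin B (S' : Set C.K) := by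
      induction h1 using Algebra.adjoin_induction with
      | mem z hz => exact Algebra.subset_adjoin hz
      | algebraMap c => exact (Algebra.adjoin B (S' : Set C.K)).algebraMap_mem (algebraMap k B c)
      | add _ _ _ _ h1 h2 => exact add_mem h1 h2
      | mul _ _ _ _ h1 h2 => exact mul_mem h1 h2
    rw [← Subalgebra.mem_toSubmodule, ← hs] at h2
    clear h1
    induction h2 using Submodule.span_induction with
    | mem e he => exact Submodule.subset_span ⟨0, e, he, by rw [pow_zero, one_mul]⟩
    | zero => exact zero_mem _
    | add _ _ _ _ h1 h2 => exact add_mem h1 h2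
    | smul r z _ h => exact hBspan r.1 r.2 z h

/-- Strong approximation away from a closed point `P`, together with a nonconstant function whose
only pole is at `P`. -/
theorem approx_ne (P : C.ClosedPoint) :
    Approx (fun x : C.ClosedPoint => C.localRing x.1) {x | x ≠ P} ∧
      ∃ f : C.K, (∀ x : C.ClosedPoint, x ≠ P → f ∈ C.localRing x.1) ∧ Transcendental k f := by
  obtain ⟨U₁, U₂, y, h₁, h₂, hcov, -, hη, hy, hy₂, hy₁, hv₂, hv₁⟩ := C.exists_charts P
  obtain ⟨s, hs, hspan⟩ := C.exists_finset_span h₂ hcov hη hy hy₂ hv₁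
  obtain ⟨E, hEfin, hE⟩ := exists_finiteDimensional (O := fun x : C.ClosedPoint => C.localRing x.1)
    (S := {x | x.1 ∈ U₁}) (T := {x | x.1 ∈ U₂}) C.finite_notMem_localRing (fun x => hcov x.1)
    (C.approx_affine h₁) (C.approx_affine h₂) hy (fun x hx => hy₂ x.1 hx)
    (fun x hx hx' => by
      obtain ⟨t, ht, h⟩ := hv₂ x.1 hx hx'
      exact h ▸ C.vanishes_toK ht)
    (fun x hx => hy₁ x.1 hx)
    (fun x hx hx' => by
      obtain ⟨t, ht, h⟩ := hv₁ x.1 hx hx'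
      exact h ▸ C.vanishes_toK ht)
    s (fun e he x hx => hs e he x.1 hx) hspan
  obtain ⟨t, ht, ht'⟩ := C.exists_inv_notMem P
  obtain ⟨f, hf, hft⟩ := exists_transcendental hE ht ht'
  exact ⟨approx_compl C.finite_notMem_localRing hE hf hft, f, hf, hft⟩

variable (F : C.scheme.Modules)

/-- The stalk at `x`, as a subgroup of the stalk at the generic point. -/
def stalkRange (x : C.scheme) : AddSubgroup (Stalk F C.η) :=
  (specialize F (genericPoint_specializes x)).range

theorem finite_notMem_stalkRange (c : Stalk F C.η) :
    {x : C.ClosedPoint | c ∉ C.stalkRange F x.1}.Finite := by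
  obtain ⟨U, hU, s, rfl⟩ := exists_germ F _ c
  exact (C.finite_closedPoints U hU).subset fun x hx hxU =>
    hx ⟨germ F U x.1 hxU s, specialize_germ F _ U hxU s⟩

/-- Strong approximation away from a closed point `P`, for a quasi-coherent sheaf. -/
theorem exists_approx [F.IsQuasicoherent] (P : C.ClosedPoint) (v : C.ClosedPoint → Stalk F C.η)
    (hv : {x | v x ∉ C.stalkRange F x.1}.Finite) :
    ∃ a : Stalk F C.η, ∀ x : C.ClosedPoint, x ≠ P → v x - a ∈ C.stalkRange F x.1 := by
  obtain ⟨happ, f, hf, hft⟩ := C.approx_ne P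
  let : Module C.K (Stalk F C.η) := CurveAdeles.instModuleStalk F C.η
  refine exists_approx_module happ hf hft (fun x => C.exists_polynomial_vanishes x)
    (fun x => C.stalkRange F x.1) ?_ (C.finite_notMem_stalkRange F) ?_ v hv
  · rintro x _ ⟨a, rfl⟩ _ ⟨m, rfl⟩
    exact ⟨a • m, specialize_smul F _ a m⟩
  · intro x c
    obtain ⟨g, m, hg, hm⟩ := exists_section F x.1 c
    exact ⟨C.toK x.1 g, (map_ne_zero_iff _ (C.toK_injective x.1)).mpr hg, m, hm⟩

end Approximation

end ProjectiveCurve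

/-! ### Quasi-isomorphisms of two-term complexes -/

section TwoTerm

variable {k : Type u} [Field k]

/-- A morphism of short complexes is a quasi-isomorphism if it is injective and surjective on cycles
modulo boundaries. -/
theorem quasiIso_of_elements {S₁ S₂ : ShortComplex (ModuleCat.{u} k)} (φ : S₁ ⟶ S₂)
    (hinj : ∀ x, S₁.g x = 0 → ∀ z, φ.τ₂ x = S₂.f z → ∃ w, S₁.f w = x)
    (hsurj : ∀ y, S₂.g y = 0 → ∃ x z, S₁.g x = 0 ∧ y = φ.τ₂ x + S₂.f z) :
    ShortComplex.QuasiIso φ := by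
  have hι (S : ShortComplex (ModuleCat.{u} k)) : Function.Injective S.iCycles :=
    (ModuleCat.mono_iff_injective _).mp inferInstance
  have hπ (S : ShortComplex (ModuleCat.{u} k)) : Function.Surjective S.homologyπ :=
    (ModuleCat.epi_iff_surjective _).mp inferInstance
  have hcyc (S : ShortComplex (ModuleCat.{u} k)) (y : S.X₂) (hy : S.g y = 0) :
      ∃ c, S.iCycles c = y :=
    (ShortComplex.moduleCat_exact_iff _).mp
      (ShortComplex.exact_of_f_is_kernel (.mk S.iCycles S.g S.iCycles_g) S.cyclesIsKernel) y hy
  have hbd (S : ShortComplex (ModuleCat.{u} k)) (c : S.cycles) (hc : S.homologyπ c = 0) :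
      ∃ a, S.toCycles a = c :=
    (ShortComplex.moduleCat_exact_iff _).mp
      (ShortComplex.exact_of_g_is_cokernel (.mk S.toCycles S.homologyπ S.toCycles_comp_homologyπ)
        S.homologyIsCokernel) c hc
  have hnat (c : S₁.cycles) : ShortComplex.homologyMap φ (S₁.homologyπ c) =
      S₂.homologyπ (ShortComplex.cyclesMap φ c) := congr($(ShortComplex.homologyπ_naturality φ) c)
  have hnat' (c : S₁.cycles) : S₂.iCycles (ShortComplex.cyclesMap φ c) = φ.τ₂ (S₁.iCycles c) :=
    congr($(ShortComplex.cyclesMap_i φ) c)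
  have hto (S : ShortComplex (ModuleCat.{u} k)) (a : S.X₁) : S.iCycles (S.toCycles a) = S.f a :=
    congr($(S.toCycles_i) a)
  have hg (S : ShortComplex (ModuleCat.{u} k)) (c : S.cycles) : S.g (S.iCycles c) = 0 :=
    congr($(S.iCycles_g) c)
  have h0 (S : ShortComplex (ModuleCat.{u} k)) (a : S.X₁) : S.homologyπ (S.toCycles a) = 0 :=
    congr($(S.toCycles_comp_homologyπ) a)
  rw [ShortComplex.quasiIso_iff, ConcreteCategory.isIso_iff_bijective]
  constructor
  · refine (injective_iff_map_eq_zero (ShortComplex.homologyMap φ).hom).mpr fun a ha => ?_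
    obtain ⟨c, rfl⟩ := hπ S₁ a
    obtain ⟨z, hz⟩ := hbd S₂ _ ((hnat c).symm.trans ha)
    obtain ⟨w, hw⟩ := hinj (S₁.iCycles c) (hg _ _) z (by rw [← hnat', ← hz, hto])
    obtain rfl : S₁.toCycles w = c := hι S₁ (by rw [hto, hw])
    exact h0 _ _
  · intro b
    obtain ⟨c, rfl⟩ := hπ S₂ b
    obtain ⟨x, z, hx, hxz⟩ := hsurj (S₂.iCycles c) (hg _ _)
    obtain ⟨c', rfl⟩ := hcyc S₁ x hx
    refine ⟨S₁.homologyπ c', (hnat c').trans ?_⟩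
    obtain rfl : ShortComplex.cyclesMap φ c' + S₂.toCycles z = c :=
      hι S₂ (by rw [map_add, hnat', hto, hxz])
    rw [map_add, h0, add_zero]

variable {A B A' B' : Type u} [AddCommGroup A] [Module k A] [AddCommGroup B] [Module k B]
  [AddCommGroup A'] [Module k A'] [AddCommGroup B'] [Module k B']

/-- The component of a two-term complex in degree `0`. -/
def twoTermXIso₀ (d : A →ₗ[k] B) : (twoTermComplex d).X 0 ≅ ModuleCat.of k A :=
  HomologicalComplex.doubleXIso₀ _ _

/-- The component of a two-term complex in degree `1`. -/
def twoTermXIso₁ (d : A →ₗ[k] B) : (twoTermComplex d).X 1 ≅ ModuleCat.of k B :=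
  HomologicalComplex.doubleXIso₁ _ _ zero_ne_one

theorem twoTerm_d (d : A →ₗ[k] B) (x : A) :
    (twoTermComplex d).d 0 1 ((twoTermXIso₀ d).inv x) = (twoTermXIso₁ d).inv (d x) := by
  have h : (twoTermComplex d).d 0 1 =
      (twoTermXIso₀ d).hom ≫ ModuleCat.ofHom d ≫ (twoTermXIso₁ d).inv :=
    HomologicalComplex.double_d _ _ zero_ne_one
  rw [h]
  exact congr($((twoTermXIso₀ d).inv_hom_id_assoc (ModuleCat.ofHom d ≫ (twoTermXIso₁ d).inv)) x)

variable {d : A →ₗ[k] B} {d' : A' →ₗ[k] B'} {f : A →ₗ[k] A'} {g : B →ₗ[k] B'}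

theorem twoTermMap_f₀ (h : d' ∘ₗ f = g ∘ₗ d) (x : A) :
    (twoTermMap d d' f g h).f 0 ((twoTermXIso₀ d).inv x) = (twoTermXIso₀ d').inv (f x) := by
  have h' : (twoTermMap d d' f g h).f 0 =
      (twoTermXIso₀ d).hom ≫ ModuleCat.ofHom f ≫ (twoTermXIso₀ d').inv :=
    HomologicalComplex.mkHomFromDouble_f₀ _ zero_ne_one _ _ _ _
  rw [h']
  exact congr($((twoTermXIso₀ d).inv_hom_id_assoc (ModuleCat.ofHom f ≫ (twoTermXIso₀ d').inv)) x)

theorem twoTermMap_f₁ (h : d' ∘ₗ f = g ∘ₗ d) (x : B) :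
    (twoTermMap d d' f g h).f 1 ((twoTermXIso₁ d).inv x) = (twoTermXIso₁ d').inv (g x) := by
  have h' : (twoTermMap d d' f g h).f 1 =
      (twoTermXIso₁ d).hom ≫ ModuleCat.ofHom g ≫ (twoTermXIso₁ d').inv :=
    HomologicalComplex.mkHomFromDouble_f₁ _ zero_ne_one _ _ _ _
  rw [h']
  exact congr($((twoTermXIso₁ d).inv_hom_id_assoc (ModuleCat.ofHom g ≫ (twoTermXIso₁ d').inv)) x)

/-- A morphism of two-term complexes is a quasi-isomorphism if it induces bijections on kernels and
cokernels. -/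
theorem quasiIso_twoTermMap (h : d' ∘ₗ f = g ∘ₗ d) (h0 : ∀ x, d x = 0 → f x = 0 → x = 0)
    (h0' : ∀ y, d' y = 0 → ∃ x, d x = 0 ∧ f x = y) (h1 : ∀ x a, g x = d' a → ∃ b, d b = x)
    (h1' : ∀ y, ∃ x a, y = g x + d' a) : QuasiIso (twoTermMap d d' f g h) := by
  have bij {X Y : ModuleCat.{u} k} (e : X ≅ Y) : Function.Bijective e.inv :=
    ConcreteCategory.bijective_of_isIso e.inv
  rw [_root_.quasiIso_iff]
  intro i
  by_cases hi0 : i = 0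
  · subst hi0
    rw [quasiIsoAt_iff' _ (-1) 0 1 (by simp) (by simp)]
    have hd : (twoTermComplex d').d (-1) 0 = 0 :=
      HomologicalComplex.double_d_eq_zero₀ _ _ _ _ (by decide)
    refine quasiIso_of_elements _ (fun x hx z hz => ⟨0, ?_⟩) fun y hy => ?_
    · obtain ⟨x, rfl⟩ := (bij (twoTermXIso₀ d)).2 x
      have hx : d x = 0 := (bij (twoTermXIso₁ d)).1
        ((twoTerm_d d x).symm.trans (hx.trans (map_zero _).symm))
      have hz : f x = 0 := (bij (twoTermXIso₀ d')).1 ((twoTermMap_f₀ h x).symm.trans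
        (hz.trans ((congr($hd z)).trans (map_zero (twoTermXIso₀ d').inv.hom).symm)))
      rw [h0 x hx hz, map_zero, map_zero]
      rfl
    · obtain ⟨y, rfl⟩ := (bij (twoTermXIso₀ d')).2 y
      have hy : d' y = 0 := (bij (twoTermXIso₁ d')).1
        ((twoTerm_d d' y).symm.trans (hy.trans (map_zero _).symm))
      obtain ⟨x, hx, rfl⟩ := h0' y hy
      refine ⟨(twoTermXIso₀ d).inv x, 0, (twoTerm_d d x).trans (by rw [hx, map_zero]; rfl), ?_⟩
      rw [map_zero, add_zero]
      exact (twoTermMap_f₀ h x).symm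
  by_cases hi1 : i = 1
  · subst hi1
    rw [quasiIsoAt_iff' _ 0 1 2 (by simp) (by simp)]
    have hd : (twoTermComplex d).d 1 2 = 0 :=
      HomologicalComplex.double_d_eq_zero₀ _ _ _ _ (by decide)
    refine quasiIso_of_elements _ (fun x _ z hz => ?_) fun y hy => ?_
    · obtain ⟨x, rfl⟩ := (bij (twoTermXIso₁ d)).2 x
      obtain ⟨z, rfl⟩ := (bij (twoTermXIso₀ d')).2 z
      obtain ⟨b, rfl⟩ := h1 x z ((bij (twoTermXIso₁ d')).1
        ((twoTermMap_f₁ h x).symm.trans (hz.trans (twoTerm_d d' z))))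
      exact ⟨(twoTermXIso₀ d).inv b, twoTerm_d d b⟩
    · obtain ⟨y, rfl⟩ := (bij (twoTermXIso₁ d')).2 y
      obtain ⟨x, a, rfl⟩ := h1' y
      refine ⟨(twoTermXIso₁ d).inv x, (twoTermXIso₀ d').inv a, congr($hd _), ?_⟩
      rw [map_add]
      exact congrArg₂ (· + ·) (twoTermMap_f₁ h x).symm (twoTerm_d d' a).symm
  have hzero {A B : Type u} [AddCommGroup A] [Module k A] [AddCommGroup B] [Module k B]
      (d : A →ₗ[k] B) : Subsingleton ((twoTermComplex d).X i) :=
    ModuleCat.isZero_iff_subsingleton.mp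
      (HomologicalComplex.isZero_double_X _ _ i hi0 hi1)
  rw [quasiIsoAt_iff]
  exact quasiIso_of_elements _ (fun _ _ _ _ => ⟨0, (hzero d).elim _ _⟩)
    fun _ _ => ⟨0, 0, map_zero _, (hzero d').elim _ _⟩

end TwoTerm

/-! ### The comparison of the two complexes -/

namespace ProjectiveCurve

section Comparison

variable {k : Type u} [Field k] (C : ProjectiveCurve k) (F : C.scheme.Modules)

theorem rational_specialize [F.IsQuasicoherent] (x : C.scheme) (m : Stalk F x) :
    C.rational F x (specialize F (genericPoint_specializes x) m) =
      C.integral F x (C.toCompletedStalk F x m) :=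
  letI := genericModule F x
  liftGeneric_apply (toGeneric F x) (isLocalizedModule_toGeneric F x) m

/-- Every element of the completed generic stalk at `x` is the sum of a rational section and
an integral element. -/
theorem exists_rational_add_integral [F.IsQuasicoherent] (x : C.ClosedPoint)
    (v : C.completedStalkTensor F x.1) :
    ∃ a b, v = C.rational F x.1 a + C.integral F x.1 b :=
  letI := genericModule F x.1
  exists_eq_liftGeneric_add (C.not_isField_stalk x) (toGeneric F x.1)
    (isLocalizedModule_toGeneric F x.1) v

variable [F.IsFinitePresentation] (hF : IsTorsionFree F)

include hF

theorem integral_injective (x : C.ClosedPoint) : Function.Injective (C.integral F x.1) := by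
  have := finite_stalk F x.1
  have := hF x.1
  exact ofHat_injective (C.not_isField_stalk x)

/-- A rational section which is integral in the completion at `x` is regular at `x`. -/
theorem mem_stalkRange (x : C.ClosedPoint) {a : Stalk F C.η} {b : C.completedStalk F x.1}
    (h : C.rational F x.1 a = C.integral F x.1 b) : a ∈ C.stalkRange F x.1 := by
  have := finite_stalk F x.1
  have := hF x.1
  let := genericModule F x.1
  exact exists_eq_of_liftGeneric_eq (C.not_isField_stalk x) (toGeneric F x.1)
    (isLocalizedModule_toGeneric F x.1) h

/-- A rational section which is integral in all completions outside of `P` is regular there. -/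
theorem exists_section_punctured (P : C.ClosedPoint) {a : Stalk F C.η}
    {b : ∀ x : C.ClosedPoint, C.completedStalk F x.1}
    (h : ∀ x ≠ P, C.rational F x.1 a = C.integral F x.1 (b x)) :
    ∃ w, C.germₗ F (C.punctured P) C.η (C.η_mem_punctured P) w = a := by
  refine exists_germ_η_eq F hF _ (C.η_mem_punctured P) a fun x hx => ?_
  by_cases hxη : x = C.η
  · subst hxη
    refine ⟨a, ?_⟩
    obtain ⟨U, hU, s, rfl⟩ := exists_germ F _ a
    exact specialize_germ F _ U hU s
  · exact C.mem_stalkRange F hF ⟨x, C.isClosed_of_ne_η hxη⟩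
      (h ⟨x, C.isClosed_of_ne_η hxη⟩ fun e => hx (congrArg Subtype.val e))

/-- Gluing gives the bijectivity on kernels and the injectivity on cokernels, strong approximation
the surjectivity on cokernels. -/
theorem quasiIso_comparison (P : C.ClosedPoint) : QuasiIso (C.comparison F P) := by
  classical
  have hloc : ∀ p : Γ(F, C.punctured P) × C.completedStalk F P.1,
      C.localComponents F P P p = p.2 := fun p => by
    have hP : P.1 ∉ C.punctured P := fun h => h rfl
    simp [localComponents, hP]
  have hsingle (z : C.completedStalkTensor F P.1) (x : C.ClosedPoint) :
      (C.comparisonOne F P z).1 x =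
        (Pi.single (M := fun x : C.ClosedPoint => C.completedStalkTensor F x.1) P z :
          ∀ x : C.ClosedPoint, C.completedStalkTensor F x.1) x := rfl
  refine quasiIso_twoTermMap _ ?_ ?_ ?_ ?_
  · rintro ⟨w, f⟩ - h
    have h1 : w = 0 := germ_η_injective F hF _ (C.η_mem_punctured P)
      ((congrArg Prod.fst h).trans (map_zero _).symm)
    have h2 := congrFun (congrArg Prod.snd h) P
    exact Prod.ext h1 ((hloc _).symm.trans h2)
  · rintro ⟨a, b⟩ h
    have h (x : C.ClosedPoint) : C.rational F x.1 a = C.integral F x.1 (b x) := by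
      have := congrFun (congrArg Subtype.val h) x
      exact sub_eq_zero.mp ((C.differences_apply F (a, b) x).symm.trans this)
    obtain ⟨w, rfl⟩ := C.exists_section_punctured F hF P fun x _ => h x
    refine ⟨(w, b P), ?_, Prod.ext rfl (funext fun x => ?_)⟩
    · rw [puncturedDifferential_apply, h, sub_self]
    · change C.localComponents F P x (w, b P) = b x
      by_cases hx : x = P
      · subst hx
        exact hloc _
      · have hx' : x.1 ∈ C.punctured P := fun e => hx (Subtype.ext e)
        refine C.integral_injective F hF x ?_
        rw [← h, C.rational_germ F _ x.1 hx']
        simp [localComponents, hx']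
  · rintro z ⟨a, b⟩ h
    have h (x : C.ClosedPoint) : (Pi.single (M := fun x : C.ClosedPoint =>
        C.completedStalkTensor F x.1) P z : ∀ x : C.ClosedPoint, C.completedStalkTensor F x.1) x =
          C.rational F x.1 a - C.integral F x.1 (b x) := by
      have := congrFun (congrArg Subtype.val h) x
      exact this.trans (C.differences_apply F (a, b) x)
    obtain ⟨w, rfl⟩ := C.exists_section_punctured F hF P fun x hx => by
      have := h x
      rw [Pi.single_eq_of_ne hx] at this
      exact sub_eq_zero.mp this.symm
    refine ⟨(w, b P), ?_⟩
    have := h P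
    rw [Pi.single_eq_same] at this
    rw [puncturedDifferential_apply, this]
  · rintro ⟨v, hv⟩
    choose a b hab using fun x => C.exists_rational_add_integral F x (v x)
    obtain ⟨c, hc⟩ := C.exists_approx F P a (hv.subset fun x hx hvx => hx (by
      obtain ⟨f, hf⟩ := hvx
      refine C.mem_stalkRange F hF x (b := f - b x) ?_
      rw [map_sub, hf, hab, add_sub_cancel_right]))
    have hm (x : C.ClosedPoint) : ∃ m, x ≠ P → C.rational F x.1 c - C.integral F x.1 m = v x := by
      by_cases hx : x = P
      · exact ⟨0, fun h => absurd hx h⟩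
      · obtain ⟨m, hm⟩ := hc x hx
        refine ⟨-(C.toCompletedStalk F x.1 m + b x), fun _ => ?_⟩
        rw [map_neg, map_add, ← rational_specialize, hm, hab x, map_sub]
        abel
    choose m hm using hm
    -- Outside of `P`, the family `v` is the coboundary of `(c, m)`. The first component corrects
    -- the difference at `P`.
    refine ⟨v P - (C.rational F P.1 c - C.integral F P.1 (m P)), (c, m),
      Subtype.ext (funext fun x => ?_)⟩
    change v x = (Pi.single (M := fun x : C.ClosedPoint => C.completedStalkTensor F x.1) P
      (v P - (C.rational F P.1 c - C.integral F P.1 (m P))) :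
        ∀ x : C.ClosedPoint, C.completedStalkTensor F x.1) x + C.differences F (c, m) x
    rw [differences_apply]
    by_cases hx : x = P
    · subst hx
      rw [Pi.single_eq_same, sub_add_cancel]
    · rw [Pi.single_eq_of_ne hx, zero_add]
      exact (hm x hx).symm

end Comparison

end ProjectiveCurve

end CurveAdeles

end

theorem proposition1 {k : Type u} [Field k] (C : CurveAdeles.ProjectiveCurve k)
    (P : C.ClosedPoint) (hP : P.1 ∈ C.str.smoothLocus)
    (F : C.scheme.Modules) [F.IsFinitePresentation] (hF : CurveAdeles.IsTorsionFree F) :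
    Function.Injective (C.germₗ F (C.punctured P) C.η (C.η_mem_punctured P)) ∧
      QuasiIso (C.comparison F P) := by
  exact ⟨CurveAdeles.germ_η_injective F hF _ (C.η_mem_punctured P),
    CurveAdeles.ProjectiveCurve.quasiIso_comparison C F hF P⟩
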